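/- **Setting.** An *HT$_c$ signature* consists of variables $\mathcal X$, a domain $\mathcal D$ and constraint atoms $\mathcal C$; each $c\in\mathcal C$ has a set $\mathrm{vars}(c)\subseteq\mathcal X$ and a denotation $[\![c]\!]$, a set of partial valuations $v:\mathcal X\to\mathcal D\cup\{\mathbf u\}$ that is upward closed under $\subseteq$ (extension of definedness) and depends only on the values of $\mathrm{vars}(c)$. Formulas are built from $\bot$ and constraint atoms with $\wedge,\vee,\to$. For $h\subseteq t$: $\langle h,t\rangle\models c$ iff $h\in[\![c]\!]$; $\wedge,\vee$ are as usual; $\langle h,t\rangle\models\varphi\to\psi$ iff for both $w\in\{h,t\}$, $\langle w,t\rangle\not\models\varphi$ or $\langle w,t\rangle\models\psi$. A valuation $t$ is a *stable model* of a set $\Gamma$ of formulas if $\langle t,t\rangle\models\Gamma$ and $\langle h,t\rangle\not\models\Gamma$ for all $h\subsetneq t$. $\Gamma,\Gamma'$ are *strongly equivalent* if $\Gamma\cup\Delta$ and $\Gamma'\cup\Delta$ have the same stable models for every set $\Delta$ of formulas. A *theory* $\mathfrak T$ has theory atoms $\mathcal T$, a family $\mathit{Sat}\subseteq 2^{\mathcal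 T}$ of satisfiable sets, an involutive complement $s\mapsto\overline s$ on $\mathcal T$, variables $\mathcal X_{\mathfrak T}$, a nonempty domain $\mathcal D_{\mathfrak T}$, sets $\mathrm{vars}(s)=\mathrm{vars}(\overline s)\subseteq\mathcal X_{\mathfrak T}$, and sets $[\![s]\!]_{\mathfrak T}$ of total assignments $\mathcal X_{\mathfrak T}\to\mathcal D_{\mathfrak T}$ that depend only on the values of $\mathrm{vars}(s)$. It is assumed to be consistent (no $S\in\mathit{Sat}$ contains both $s$ and $\overline s$), compositional ($S\in\mathit{Sat}$ iff $\bigcap_{s\in S}[\![s]\!]_{\mathfrak T}\ne\emptyset$) and to have an absolute complement ($[\![\overline s]\!]_{\mathfrak T}$ is the set complement of $[\![s]\!]_{\mathfrak T}$). A *$\mathcal T$-program* over regular atoms $\mathcal A$ and theory atoms $\mathcal T$ is a set of rules $b_0\leftarrow b_1,\dots,b_n,\neg b_{n+1},\dots,\neg b_m$ with $b_i\in\mathcal A\cup\mathcal T$ for $i\ge1$ and $b_0\in\mathcal A\cup\mathcal T\cup\{\bot\}$. Fix any HT$_c$ signature with $\mathcal A\sqcup\mathcal X_{\mathfrak T}\subseteq\mathcal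 X$, $\mathcal D_{\mathfrak T}\cup\{\mathbf t\}\subseteq\mathcal D$, whose constraint atoms include: $x{:}\mathcal D'$ for all $x\in\mathcal X$, $\mathcal D'\subseteq\mathcal D$, with variable $x$ and denotation $\{v: v(x)\in\mathcal D'\}$ (write $\mathit{def}(x)$ for $x{:}\mathcal D$); each $a\in\mathcal A$, with variable $a$ and denotation $\{v: v(a)=\mathbf t\}$; and for each $s\in\mathcal T$ an atom $\tau(s)$ with $\mathrm{vars}(\tau(s))=\mathrm{vars}(s)$ and denotation $\{v:\exists w\in[\![s]\!]_{\mathfrak T},\ v=w\text{ on }\mathrm{vars}(s)\}$. For a set $E\subseteq\mathcal T$ of external atoms, $\tau(P,\mathfrak T,E)$ consists of the rules of $P$ read as implications with each theory atom $s$ replaced by $\tau(s)$, the atoms $\mathit{def}(x)$ for $x\in\mathrm{vars}(E)=\bigcup_{s\in E}\mathrm{vars}(s)$, the formulas $\mathit{def}(x)\to x{:}\mathcal D_{\mathfrak T}$ for $x\in\mathcal X_{\mathfrak T}$, and $\mathit{def}(a)\to a$ for $a\in\mathcal A$. Programs $P,Q$ are *strongly equivalent w.r.t. $\mathfrak T$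 and $E$* if $\tau(P,\mathfrak T,E)$ and $\tau(Q,\mathfrak T,E)$ are strongly equivalent. **Complexity.** $\mathsf{NP}^O$ is the class of decision problems decided by a nondeterministic Turing machine with oracle $O$ in polynomial time (all computation paths are polynomially bounded; an oracle call takes one step), and $\mathsf{coNP}^O$ is the class of the complementary problems. Regular atoms, theory atoms and theory variables are written as binary words by injective encodings such that the maps $s\mapsto\overline s$ and $s\mapsto$ (a list of the finite set $\mathrm{vars}(s)$) are computable in polynomial time; finite programs and finite lists of atoms are coded accordingly. **Theorem.** Let $\mathfrak T$ be a theory as above and let $O$ be an oracle that decides, for finite sets $S\subseteq\mathcal T$, whether $S\in\mathit{Sat}$. Then deciding strong equivalence of two finite $\mathcal T$-programs with theory $\mathfrak T$ is in $\mathsf{coNP}^O$, in both of the following forms: 1. for every fixed set $E\subseteq\mathcal T$ of external atoms for which $x\in\mathrm{vars}(E)$ is decidable in polynomial time: given finite $P,Q$, decide whether they are strongly equivalent w.r.t. $\mathfrak T$ and $E$; 2. given a finite set $E\subseteq\mathcal T$ and finite $P,Q$, decide whether $P,Q$ are strongly equivalent w.r.t. $\mathfrak T$ and $E$. -/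

import Mathlib

/-! ## Here-and-There with constraints -/

namespace HTc

/-- A (partial) valuation; `none` plays the role of the value "undefined". -/
abbrev Valuation (X D : Type*) := X → Option D

/-- `v ⊆ v'`: every variable that is defined in `v` has the same value in `v'`. -/
def Valuation.Le {X D : Type*} (v v' : Valuation X D) : Prop :=
  ∀ x d, v x = some d → v' x = some d

/-- A signature `⟨X, D, C⟩` (variables, domain, constraint atoms) with the variables and the
denotation of each constraint atom. Denotations are monotone with respect to definedness and
depend only on the variables of the atom. -/
structure Signature (X D C : Type*) where
  vars : C → Set X
  den : C → Set (Valuation X D)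
  den_mono : ∀ c v v', v ∈ den c → Valuation.Le v v' → v' ∈ den c
  den_congr : ∀ c v v', (∀ x ∈ vars c, v x = v' x) → (v ∈ den c ↔ v' ∈ den c)

/-- Formulas over a set `C` of constraint atoms. -/
inductive Formula (C : Type*) where
  | bot : Formula C
  | atom : C → Formula C
  | and : Formula C → Formula C → Formula C
  | or : Formula C → Formula C → Formula C
  | imp : Formula C → Formula C → Formula C

namespace Formula

/-- `⊤` is `⊥ → ⊥`. -/
def top {C : Type*} : Formula C := imp bot bot

/-- `¬ φ` is `φ → ⊥`. -/
def neg {C : Type*} (φ : Formula C) : Formula C := imp φ bot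

/-- Conjunction of a list of formulas (`⊤` for the empty list). -/
def conj {C : Type*} (l : List (Formula C)) : Formula C := l.foldr and top

end Formula

section Semantics

variable {X D C : Type*}

/-- `Sat S t h φ` is `⟨h, t⟩ ⊨ φ`. -/
def Sat (S : Signature X D C) (t : Valuation X D) : Valuation X D → Formula C → Prop
  | _, Formula.bot => False
  | h, Formula.atom c => h ∈ S.den c
  | h, Formula.and φ ψ => Sat S t h φ ∧ Sat S t h ψ
  | h, Formula.or φ ψ => Sat S t h φ ∨ Sat S t h ψ
  | h, Formula.imp φ ψ => (¬ Sat S t h φ ∨ Sat S t h ψ) ∧ (¬ Sat S t t φ ∨ Sat S t t ψ)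

/-- `⟨h, t⟩` is a model of the theory `G`. -/
def Models (S : Signature X D C) (h t : Valuation X D) (G : Set (Formula C)) : Prop :=
  ∀ φ ∈ G, Sat S t h φ

/-- `t` is a stable model of `G`, i.e. `⟨t, t⟩` is an equilibrium model of `G`. -/
def IsStable (S : Signature X D C) (t : Valuation X D) (G : Set (Formula C)) : Prop :=
  Models S t t G ∧ ∀ h, Valuation.Le h t → h ≠ t → ¬ Models S h t G

/-- Strong equivalence of theories: same stable models in every context `Δ`. -/
def StronglyEquivalent (S : Signature X D C) (G G' : Set (Formula C)) : Prop :=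
  ∀ Δ : Set (Formula C), ∀ t, IsStable S t (G ∪ Δ) ↔ IsStable S t (G' ∪ Δ)

end Semantics

end HTc

/-! ## External theories and `𝒯`-programs -/

namespace TProg

/-- An abstract theory: the satisfiable sets of theory atoms, and an involutive complement. -/
structure AbstractTheory (T : Type*) where
  Sat : Set (Set T)
  comp : T → T
  comp_comp : ∀ s, comp (comp s) = s

/-- An abstract theory with a structure: variables `X`, domain `D`, variables of a theory atom and
denotation of a theory atom, as a set of total assignments. -/
structure StructuredTheory (T X D : Type*) extends AbstractTheory T where
  vars : T → Set X
  vars_comp : ∀ s, vars (comp s) = vars s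
  den : T → Set (X → D)
  den_congr : ∀ s v w, (∀ x ∈ vars s, v x = w x) → (v ∈ den s ↔ w ∈ den s)

namespace StructuredTheory

variable {T X D : Type*} (𝔗 : StructuredTheory T X D)

/-- The denotation of a set of theory atoms. -/
def denSet (S : Set T) : Set (X → D) := ⋂ s ∈ S, 𝔗.den s

/-- No satisfiable set contains complementary atoms. -/
def Consistent : Prop := ∀ S ∈ 𝔗.Sat, ∀ s ∈ S, 𝔗.comp s ∉ S

/-- A set is satisfiable iff its denotation is nonempty. -/
def Compositional : Prop := 𝔗.Sat = {S | (𝔗.denSet S).Nonempty}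

/-- The complement of an atom denotes the set complement of its denotation. -/
def AbsoluteComplement : Prop := ∀ s, 𝔗.den (𝔗.comp s) = (𝔗.den s)ᶜ

/-- The variables that occur in a set of theory atoms. -/
def varsSet (E : Set T) : Set X := {x | ∃ s ∈ E, x ∈ 𝔗.vars s}

end StructuredTheory

/-- A rule `b₀ ← b₁, …, bₙ, ¬bₙ₊₁, …, ¬bₘ` over regular atoms `A` and theory atoms `T`;
the head `none` stands for `⊥`. -/
structure Rule (A T : Type*) where
  head : Option (A ⊕ T)
  pos : List (A ⊕ T)
  neg : List (A ⊕ T)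

open HTc

/-- The regular atoms `A` and the structured theory `𝔗` are encoded in the signature `S`.
Regular atoms and theory variables are variables of `S`, and the domain of `S` contains the one of
`𝔗` and a truth constant. `S` has constraint atoms `dom D' x` (`x` has a value in `D'`), one for each
regular atom (its variable is true), and one, `τ(s)`, for each theory atom `s`: it has the same
variables as `s`, and it holds in the valuations that coincide on these variables
with some assignment in the denotation of `s`. -/
structure Encodes {X' D' C T X D : Type*} (A : Type*) (S : Signature X' D' C)
    (𝔗 : StructuredTheory T X D) where
  var : A ⊕ X ↪ X'
  val : D ↪ D'
  tt : D'
  dom : Set D' → X' → C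
  vars_dom : ∀ U x, S.vars (dom U x) = {x}
  den_dom : ∀ U x, S.den (dom U x) = {v | ∃ d ∈ U, v x = some d}
  reg : A → C
  vars_reg : ∀ a, S.vars (reg a) = {var (Sum.inl a)}
  den_reg : ∀ a, S.den (reg a) = {v | v (var (Sum.inl a)) = some tt}
  thy : T → C
  vars_thy : ∀ s, S.vars (thy s) = (fun x => var (Sum.inr x)) '' 𝔗.vars s
  den_thy : ∀ s, S.den (thy s) =
    {v | ∃ w ∈ 𝔗.den s, ∀ x ∈ 𝔗.vars s, v (var (Sum.inr x)) = some (val (w x))}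

namespace Encodes

variable {X' D' C T X D A : Type*} {S : Signature X' D' C} {𝔗 : StructuredTheory T X D}
  (e : Encodes A S 𝔗)

/-- `def(x)`: the variable `x` has some value. -/
def defined (x : X') : Formula C := Formula.atom (e.dom Set.univ x)

/-- Translation of an atom. -/
def tauAtom : A ⊕ T → Formula C
  | Sum.inl a => Formula.atom (e.reg a)
  | Sum.inr s => Formula.atom (e.thy s)

/-- Translation of a rule body. -/
def tauBody (r : Rule A T) : Formula C :=
  Formula.conj (r.pos.map e.tauAtom ++ r.neg.map fun b => (e.tauAtom b).neg)

/-- Translation of a rule head. -/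
def tauHead (r : Rule A T) : Formula C :=
  match r.head with
  | none => Formula.bot
  | some b => e.tauAtom b

/-- Translation of a rule. -/
def tauRule (r : Rule A T) : Formula C := Formula.imp (e.tauBody r) (e.tauHead r)

/-- Axioms for the external atoms: `def(x)` for all variables `x` of atoms in `E`. -/
def extAxioms (E : Set T) : Set (Formula C) :=
  {φ | ∃ x ∈ 𝔗.varsSet E, φ = e.defined (e.var (Sum.inr x))}

/-- Domain axioms: `def(x) → x ∈ D` for all variables of `𝔗`, and `def(a) → a` for
all regular atoms `a`. -/
def domAxioms : Set (Formula C) :=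
  {φ | ∃ x : X, φ = Formula.imp (e.defined (e.var (Sum.inr x)))
      (Formula.atom (e.dom (Set.range e.val) (e.var (Sum.inr x))))} ∪
  {φ | ∃ a : A, φ = Formula.imp (e.defined (e.var (Sum.inl a))) (Formula.atom (e.reg a))}

/-- The translation `τ(P, 𝔗, E)` of a program `P` with set `E` of external atoms. -/
def tau (P : Set (Rule A T)) (E : Set T) : Set (Formula C) :=
  e.tauRule '' P ∪ e.extAxioms E ∪ e.domAxioms

/-- Strong equivalence of programs with respect to the theory `𝔗` and the external atoms `E`. -/
def ProgStronglyEquivalent (E : Set T) (P Q : Set (Rule A T)) : Prop :=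
  StronglyEquivalent S (e.tau P E) (e.tau Q E)

end Encodes

end TProg

/-! ## Nondeterministic oracle machines and the class `coNP` relative to an oracle -/

namespace Cplx

/-- A nondeterministic oracle machine. It is a finite-control machine in Mathlib's model `FinTM2` of
multi-tape Turing machines (the one by which Mathlib defines polynomial time), with a second
transition function `m'`: in each step one of `tm.m` and `m'` is applied. The stack `tm.k₁`
is the oracle tape. In state `query` the machine moves, in a single step, to state `yes` or `no`,
according to whether the word on the oracle tape belongs to the oracle. It accepts by reaching the
state `accept`. -/
structure OracleNTM where
  tm : Turing.FinTM2
  m' : tm.Λ → Turing.TM2.Stmt tm.Γ tm.Λ tm.σ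
  inBit : tm.Γ tm.k₀ ≃ Bool
  queryBit : tm.Γ tm.k₁ ≃ Bool
  query : tm.Λ
  yes : tm.Λ
  no : tm.Λ
  accept : tm.Λ

namespace OracleNTM

/-- Configurations: a state (or `none`, halted without accepting), internal memory, stacks. -/
abbrev Config (M : OracleNTM) : Type := Turing.TM2.Cfg M.tm.Γ M.tm.Λ M.tm.σ

/-- The initial configuration on an input word. -/
def init (M : OracleNTM) (w : List Bool) : M.Config :=
  Turing.initList M.tm (w.map M.inBit.symm)

/-- One step with oracle `O`. There is no step from state `accept` and from halted
configurations. -/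
inductive Step (M : OracleNTM) (O : Set (List Bool)) : M.Config → M.Config → Prop
  | fst (l : M.tm.Λ) (v : M.tm.σ) (s : ∀ k, List (M.tm.Γ k)) :
      l ≠ M.accept → l ≠ M.query →
      Step M O ⟨some l, v, s⟩ (Turing.TM2.stepAux (M.tm.m l) v s)
  | snd (l : M.tm.Λ) (v : M.tm.σ) (s : ∀ k, List (M.tm.Γ k)) :
      l ≠ M.accept → l ≠ M.query →
      Step M O ⟨some l, v, s⟩ (Turing.TM2.stepAux (M.m' l) v s)
  | yes (v : M.tm.σ) (s : ∀ k, List (M.tm.Γ k)) :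
      M.query ≠ M.accept → (s M.tm.k₁).map M.queryBit ∈ O →
      Step M O ⟨some M.query, v, s⟩ ⟨some M.yes, v, s⟩
  | no (v : M.tm.σ) (s : ∀ k, List (M.tm.Γ k)) :
      M.query ≠ M.accept → (s M.tm.k₁).map M.queryBit ∉ O →
      Step M O ⟨some M.query, v, s⟩ ⟨some M.no, v, s⟩

/-- `Run M O n c c'`: some computation path of exactly `n` steps leads from `c` to `c'`. -/
inductive Run (M : OracleNTM) (O : Set (List Bool)) : ℕ → M.Config → M.Config → Prop
  | refl (c : M.Config) : Run M O 0 c c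
  | tail {n : ℕ} {c c' c'' : M.Config} : Run M O n c c' → Step M O c' c'' → Run M O (n + 1) c c''

/-- Some computation path of `M` with oracle `O` on input `w` is accepting. -/
def Accepts (M : OracleNTM) (O : Set (List Bool)) (w : List Bool) : Prop :=
  ∃ n c, M.Run O n (M.init w) c ∧ c.l = some M.accept

/-- No computation path of `M` with oracle `O` on input `w` is longer than `b`. -/
def HaltsWithin (M : OracleNTM) (O : Set (List Bool)) (w : List Bool) (b : ℕ) : Prop :=
  ∀ n c, M.Run O n (M.init w) c → n ≤ b

end OracleNTM

/-- The decision problem `L` on the instances `α`, given by the words `code x`, is in `NP` with oracle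
`O`: a nondeterministic oracle machine decides it in polynomial time. -/
def InNP {α : Type*} (O : Set (List Bool)) (code : α → List Bool) (L : Set α) : Prop :=
  ∃ (M : OracleNTM) (p : Polynomial ℕ), ∀ x : α,
    M.HaltsWithin O (code x) (p.eval (code x).length) ∧ (M.Accepts O (code x) ↔ x ∈ L)

/-- The complementary problem is in `NP` with oracle `O`. -/
def InCoNP {α : Type*} (O : Set (List Bool)) (code : α → List Bool) (L : Set α) : Prop :=
  InNP O code Lᶜ

/-! ### Codes of programs as words -/

/-- Self-delimiting code of a word: each bit is preceded by `true`, and `false` ends the block. -/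
def block (w : List Bool) : List Bool := (w.flatMap fun b => [true, b]) ++ [false]

/-- Code of a list: the blocks of the codes of its members. -/
def codeList {α : Type*} (code : α → List Bool) (l : List α) : List Bool :=
  l.flatMap fun a => block (code a)

section Codes

variable {A T : Type*} (codeA : A → List Bool) (codeT : T → List Bool)

/-- Code of an atom, with a bit that tells regular atoms from theory atoms. -/
def codeAtom : A ⊕ T → List Bool
  | Sum.inl a => false :: codeA a
  | Sum.inr s => true :: codeT s

/-- Code of a rule head; `⊥` has the empty code. -/
def codeHead : Option (A ⊕ T) → List Bool
  | none => []
  | some b => codeAtom codeA codeT b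

/-- Code of a rule. -/
def codeRule (r : TProg.Rule A T) : List Bool :=
  block (codeHead codeA codeT r.head) ++
    block (codeList (codeAtom codeA codeT) r.pos) ++
    block (codeList (codeAtom codeA codeT) r.neg)

/-- Code of a finite program. -/
def codeProgram (P : List (TProg.Rule A T)) : List Bool := codeList (codeRule codeA codeT) P

/-- Code of a pair of finite programs. -/
def codePair (x : List (TProg.Rule A T) × List (TProg.Rule A T)) : List Bool :=
  block (codeProgram codeA codeT x.1) ++ block (codeProgram codeA codeT x.2)

/-- Code of a finite set of theory atoms and a pair of finite programs. -/
def codeTriple (x : List T × List (TProg.Rule A T) × List (TProg.Rule A T)) : List Bool :=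
  block (codeList codeT x.1) ++ codePair codeA codeT x.2

end Codes

end Cplx

/-! Two theories are strongly equivalent iff they have the same here-and-there models
(`stronglyEquivalent_iff`). The constraint atoms `x:D'` suffice to build the separating contexts:
one pins down all values of `t`, the other leaves only `h` and `t` as candidates.

For translated programs the axioms force the theory variables to take values in the domain of the
theory and the regular atoms to be either undefined or true. Hence in a model `⟨h, t⟩` all values of
theory variables come from a single total assignment `w`, and `h`, `t` differ only in what is
defined. A theory atom is true iff its variables are defined and `w` satisfies it. Only the finite
list `L` of atoms of the two programs matters, and a counterexample is described by three sublists
of `L`: the atoms defined in `h`, those defined in `t`, and the theory atoms satisfied by `w`. The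
interpretation may be shrunk to the least one that defines these atoms and the external variables
(`Truth`); this changes the truth of no atom in `L` (`exists_distinguishing`,
`not_progStronglyEquivalent`).

So non-equivalence has a certificate of `3 * L.length` bits. Checking it means evaluating both
programs, which takes polynomial time, and making sure that `w` exists. By compositionality and
absolute complement the latter is one oracle query: is the set consisting of the selected theory
atoms and the complements of the other ones in `L` satisfiable (`signed_mem_sat`)?

To make this a statement on machines, commands over four stacks, with calls of the machines given by
the hypotheses, are compiled into `FinTM2` programs (`Exec.dRun`). A fixed nondeterministic frame
guesses a word as long as the input, runs the compiled command, tests one bit and asks one query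
(`inNP_of_exec`). The predicate `Poly` is closed under composition, case distinction, bounded
iteration and folds over lists, so that polynomial time of the check is read off its definition. -/

namespace HTc

/-! ### Strong equivalence and here-and-there models -/

section

variable {X D C : Type*} {S : Signature X D C}

/-- Atoms persist because denotations are monotone; the clause for implication already contains the
condition at `t`. -/
theorem Sat.persist {t h : Valuation X D} (hle : Valuation.Le h t) {φ : Formula C}
    (hφ : Sat S t h φ) : Sat S t t φ := by
  induction φ with
  | bot => exact hφ
  | atom c => exact S.den_mono c h t hφ hle
  | and φ ψ ih₁ ih₂ => exact ⟨ih₁ hφ.1, ih₂ hφ.2⟩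
  | or φ ψ ih₁ ih₂ => exact hφ.imp ih₁ ih₂
  | imp φ ψ _ _ => exact ⟨hφ.2, hφ.2⟩

theorem Valuation.Le.refl (t : Valuation X D) : Valuation.Le t t := fun _ _ h => h

theorem StronglyEquivalent.symm {G G' : Set (Formula C)} (hs : StronglyEquivalent S G G') :
    StronglyEquivalent S G' G := fun Δ t => (hs Δ t).symm

theorem StronglyEquivalent.models {G G' : Set (Formula C)} (dom : Set D → X → C)
    (den_dom : ∀ U x, S.den (dom U x) = {v | ∃ d ∈ U, v x = some d})
    (hs : StronglyEquivalent S G G') {h t : Valuation X D} (hle : Valuation.Le h t)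
    (hG : Models S h t G) : Models S h t G' := by
  have sat_dom : ∀ (v : Valuation X D) (d : D) (x : X),
      Sat S t v (.atom (dom {d} x)) ↔ v x = some d := fun v d x => by simp [Sat, den_dom]
  by_contra hG'
  have htG : Models S t t G := fun φ hφ => (hG φ hφ).persist hle
  have htG' : Models S t t G' := by
    -- A context that states every value of `t` excludes all smaller valuations. So `t` is stable
    -- for `G ∪ Δ`, hence a model of `G'`.
    let Δ : Set (Formula C) := {φ | ∃ x d, t x = some d ∧ φ = .atom (dom {d} x)}
    have : IsStable S t (G ∪ Δ) := by
      refine ⟨?_, fun h' hle' hne hm => hne ?_⟩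
      · rintro φ (hφ | ⟨x, d, hx, rfl⟩)
        · exact htG φ hφ
        · exact (sat_dom t d x).2 hx
      · funext x
        cases hx : t x with
        | some d => exact (sat_dom h' d x).1 (hm _ (.inr ⟨x, d, hx, rfl⟩))
        | none =>
          cases hx' : h' x with
          | none => rfl
          | some d => rw [hle' x d hx'] at hx; cases hx
    exact fun φ hφ => ((hs Δ t).1 this).1 φ (.inl hφ)
  -- The facts force a candidate to extend `h`; the implications force it to be all of `t` once it
  -- defines a variable that `h` does not. Only `h` and `t` remain, and as `h` is a model of `G` but
  -- not of `G'`, `t` is stable for `G' ∪ Δ` only.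
  let Δ : Set (Formula C) := {φ | ∃ x d, h x = some d ∧ φ = .atom (dom {d} x)} ∪
    {φ | ∃ x d y d', t x = some d ∧ t y = some d' ∧ h x = none ∧
      φ = .imp (.atom (dom {d} x)) (.atom (dom {d'} y))}
  have hΔ : ∀ v, Valuation.Le h v → Valuation.Le v t → (v = h ∨ v = t) → Models S v t Δ := by
    rintro v hhv hvt hv φ (⟨x, d, hx, rfl⟩ | ⟨x, d, y, d', hx, hy, hnx, rfl⟩)
    · exact (sat_dom v d x).2 (hhv x d hx)
    · refine ⟨?_, .inr ((sat_dom t d' y).2 hy)⟩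
      rcases hv with rfl | rfl
      · left
        rw [sat_dom, hnx]
        simp
      · exact .inr ((sat_dom v d' y).2 hy)
  have hst : IsStable S t (G' ∪ Δ) := by
    refine ⟨?_, fun h' hle' hne hm => ?_⟩
    · rintro φ (hφ | hφ)
      · exact htG' φ hφ
      · exact hΔ t hle (.refl t) (.inr rfl) φ hφ
    · have hhh' : Valuation.Le h h' := fun x d hx =>
        (sat_dom h' d x).1 (hm _ (.inr (.inl ⟨x, d, hx, rfl⟩)))
      by_cases hx : ∃ x d, h' x = some d ∧ h x = none
      · obtain ⟨x, d, hx, hnx⟩ := hx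
        refine hne ?_
        funext y
        cases hy : t y with
        | some d' =>
          have := (hm _ (.inr (.inr ⟨x, d, y, d', hle' x d hx, hy, hnx, rfl⟩))).1
          rw [sat_dom, sat_dom] at this
          exact this.resolve_left fun h => h hx
        | none =>
          cases hy' : h' y with
          | none => rfl
          | some d' => rw [hle' y d' hy'] at hy; cases hy
      · refine hG' ?_
        have : h' = h := by
          funext x
          cases hx' : h' x with
          | some d =>
            cases hhx : h x with
            | none => exact absurd ⟨x, d, hx', hhx⟩ hx
            | some d' => rw [← hx', hhh' x d' hhx]
          | none =>
            cases hhx : h x with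
            | none => rfl
            | some d' => rw [hhh' x d' hhx] at hx'; cases hx'
        exact this ▸ fun φ hφ => hm φ (.inl hφ)
  refine ((hs Δ t).2 hst).2 h hle ?_ ?_
  · rintro rfl
    exact hG' htG'
  · rintro φ (hφ | hφ)
    · exact hG φ hφ
    · exact hΔ h (.refl h) hle (.inl rfl) φ hφ

/-- Theories are strongly equivalent iff they have the same here-and-there models. -/
theorem stronglyEquivalent_iff {G G' : Set (Formula C)} (dom : Set D → X → C)
    (den_dom : ∀ U x, S.den (dom U x) = {v | ∃ d ∈ U, v x = some d}) :
    StronglyEquivalent S G G' ↔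
      ∀ h t, Valuation.Le h t → (Models S h t G ↔ Models S h t G') := by
  refine ⟨fun hs h t hle => ⟨hs.models dom den_dom hle, hs.symm.models dom den_dom hle⟩,
    fun hm Δ t => ?_⟩
  have key : ∀ h, Valuation.Le h t → (Models S h t (G ∪ Δ) ↔ Models S h t (G' ∪ Δ)) := by
    intro h hle
    have := hm h t hle
    simp only [Models, Set.mem_union, or_imp, forall_and] at this ⊢
    rw [this]
  exact and_congr (key t (.refl t))
    (forall_congr' fun h => forall_congr' fun hle => imp_congr_right fun _ => not_congr (key h hle))

end

end HTc

/-! ### Models of translated programs, described by finitely many atoms -/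

namespace TProg

open HTc

/-- The atoms of a rule. -/
def Rule.atoms {A T : Type*} (r : Rule A T) : List (A ⊕ T) := r.head.toList ++ r.pos ++ r.neg

/-- The rule holds if `M` are the true atoms and `N` the ones that are relevant for negation. -/
def Rule.Holds {A T : Type*} (M N : A ⊕ T → Prop) (r : Rule A T) : Prop :=
  (∀ b ∈ r.pos, M b) → (∀ b ∈ r.neg, ¬ N b) → ∃ b, r.head = some b ∧ M b

theorem Rule.holds_congr {A T : Type*} {M N M' N' : A ⊕ T → Prop} {r : Rule A T}
    (hM : ∀ b ∈ r.atoms, (M b ↔ M' b)) (hN : ∀ b ∈ r.atoms, (N b ↔ N' b)) :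
    r.Holds M N ↔ r.Holds M' N' := by
  have h₁ : ∀ b ∈ r.pos, b ∈ r.atoms := fun b hb => by simp [atoms, hb]
  have h₂ : ∀ b ∈ r.neg, b ∈ r.atoms := fun b hb => by simp [atoms, hb]
  have h₃ : ∀ b, r.head = some b → b ∈ r.atoms := fun b hb => by simp [atoms, hb]
  refine imp_congr (forall₂_congr fun b hb => hM b (h₁ b hb)) (imp_congr
    (forall₂_congr fun b hb => not_congr (hN b (h₂ b hb))) (exists_congr fun b =>
      and_congr_right fun hb => hM b (h₃ b hb)))

/-- The rules hold in the here-and-there interpretation with true atoms `M` and `N`. -/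
def HoldsAll {A T : Type*} (M N : A ⊕ T → Prop) (P : List (Rule A T)) : Prop :=
  ∀ r ∈ P, r.Holds M N ∧ r.Holds N N

theorem holdsAll_congr {A T : Type*} {M N M' N' : A ⊕ T → Prop} {P : List (Rule A T)}
    (hM : ∀ r ∈ P, ∀ b ∈ r.atoms, (M b ↔ M' b)) (hN : ∀ r ∈ P, ∀ b ∈ r.atoms, (N b ↔ N' b)) :
    HoldsAll M N P ↔ HoldsAll M' N' P :=
  forall₂_congr fun r hr => and_congr (r.holds_congr (hM r hr) (hN r hr))
    (r.holds_congr (hN r hr) (hN r hr))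

/-- The truth of an atom in the least interpretation in which the external variables `V` and the
atoms in `M` are defined, where the theory atoms in `W` are satisfied by the assignment. -/
def Truth {A T X D : Type*} (𝔗 : StructuredTheory T X D) (V : Set X) (W M : List (A ⊕ T)) :
    A ⊕ T → Prop
  | .inl a => .inl a ∈ M
  | .inr s => .inr s ∈ W ∧ ∀ x ∈ 𝔗.vars s, x ∈ V ∨ ∃ s', .inr s' ∈ M ∧ x ∈ 𝔗.vars s'

namespace Encodes

variable {X' D' C T X D A : Type*} {S : Signature X' D' C} {𝔗 : StructuredTheory T X D}
  (e : Encodes A S 𝔗)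

/-- The atom is true in the valuation. -/
def True (v : Valuation X' D') (b : A ⊕ T) : Prop := Sat S v v (e.tauAtom b)

variable {e} {h t : Valuation X' D'}

theorem sat_tauAtom (b : A ⊕ T) : Sat S t h (e.tauAtom b) ↔ e.True h b := by
  cases b <;> rfl

theorem True.mono (hle : Valuation.Le h t) {b : A ⊕ T} (hb : e.True h b) : e.True t b :=
  Sat.persist hle ((sat_tauAtom b).2 hb)

theorem sat_conj (l : List (Formula C)) :
    Sat S t h (Formula.conj l) ↔ ∀ φ ∈ l, Sat S t h φ := by
  induction l with
  | nil => simp [Formula.conj, Formula.top, Sat]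
  | cons φ l ih =>
    have : Sat S t h (Formula.conj (φ :: l)) ↔ Sat S t h φ ∧ Sat S t h (Formula.conj l) := Iff.rfl
    rw [this, ih]
    simp

/-- By persistence, failure of an atom at `t` implies its failure at `h`, so negated atoms are
evaluated at `t` alone. -/
theorem sat_tauBody (hle : Valuation.Le h t) (r : Rule A T) : Sat S t h (e.tauBody r) ↔
    (∀ b ∈ r.pos, e.True h b) ∧ ∀ b ∈ r.neg, ¬ e.True t b := by
  have hneg : ∀ b : A ⊕ T, Sat S t h (e.tauAtom b).neg ↔ ¬ e.True t b := fun b => by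
    simp only [Formula.neg, Sat, or_false, sat_tauAtom]
    exact ⟨And.right, fun hb => ⟨fun hb' => hb (hb'.mono hle), hb⟩⟩
  rw [tauBody, sat_conj]
  simp only [List.mem_append, List.mem_map, or_imp, forall_and, forall_exists_index, and_imp,
    forall_apply_eq_imp_iff₂, sat_tauAtom, hneg]

theorem sat_tauHead (r : Rule A T) :
    Sat S t h (e.tauHead r) ↔ ∃ b, r.head = some b ∧ e.True h b := by
  cases hr : r.head with
  | none => simp [tauHead, hr, Sat]
  | some b => simp [tauHead, hr, sat_tauAtom]

theorem sat_tauRule (hle : Valuation.Le h t) (r : Rule A T) : Sat S t h (e.tauRule r) ↔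
    r.Holds (e.True h) (e.True t) ∧ r.Holds (e.True t) (e.True t) := by
  simp only [tauRule, Sat, sat_tauBody hle, sat_tauBody (.refl t), sat_tauHead, Rule.Holds,
    ← imp_iff_not_or, and_imp]

theorem models_tau (hle : Valuation.Le h t) (P : List (Rule A T)) (E : Set T) :
    Models S h t (e.tau {r | r ∈ P} E) ↔
      HoldsAll (e.True h) (e.True t) P ∧ Models S h t (e.extAxioms E ∪ e.domAxioms) := by
  simp only [Models, tau, Set.mem_union, or_imp, forall_and, HoldsAll, and_assoc, Set.mem_image,
    Set.mem_ofPred_eq, forall_exists_index, and_imp, forall_apply_eq_imp_iff₂, sat_tauRule hle]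

/-- Both translations contain the same axioms, so these become a common side condition on `⟨h, t⟩`.
-/
theorem progStronglyEquivalent_iff (E : Set T) (P Q : List (Rule A T)) :
    e.ProgStronglyEquivalent E {r | r ∈ P} {r | r ∈ Q} ↔ ∀ h t, Valuation.Le h t →
      Models S h t (e.extAxioms E ∪ e.domAxioms) →
      (HoldsAll (e.True h) (e.True t) P ↔ HoldsAll (e.True h) (e.True t) Q) := by
  rw [ProgStronglyEquivalent, stronglyEquivalent_iff e.dom e.den_dom]
  refine forall₂_congr fun h t => forall_congr' fun hle => ?_
  rw [models_tau hle, models_tau hle]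
  exact and_congr_left_iff

theorem sat_defined (x : X') : Sat S t h (e.defined x) ↔ h x ≠ none := by
  simp [defined, Sat, e.den_dom, Option.ne_none_iff_exists']

/-- The domain axioms are checked at both `h` and `t`, but the conditions at `t` are inherited by `h
⊆ t`. For the external variables it is the condition at `h` that counts. -/
theorem models_axioms (hle : Valuation.Le h t) (E : Set T) :
    Models S h t (e.extAxioms E ∪ e.domAxioms) ↔
      (∀ x ∈ 𝔗.varsSet E, h (e.var (.inr x)) ≠ none) ∧
      (∀ x d, t (e.var (.inr x)) = some d → d ∈ Set.range e.val) ∧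
      (∀ a d, t (e.var (.inl a)) = some d → d = e.tt) := by
  have h₁ : ∀ (v : Valuation X' D') (x : X), (¬ v (e.var (.inr x)) ≠ none ∨
      v ∈ S.den (e.dom (Set.range e.val) (e.var (.inr x)))) ↔
      ∀ d, v (e.var (.inr x)) = some d → d ∈ Set.range e.val := fun v x => by
    rw [e.den_dom]
    cases hv : v (e.var (.inr x)) <;> simp [hv, eq_comm]
  have h₂ : ∀ (v : Valuation X' D') (a : A), (¬ v (e.var (.inl a)) ≠ none ∨
      v ∈ S.den (e.reg a)) ↔ ∀ d, v (e.var (.inl a)) = some d → d = e.tt := fun v a => by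
    rw [e.den_reg]
    cases hv : v (e.var (.inl a)) <;> simp [hv]
  simp only [Models, extAxioms, domAxioms, Set.mem_union, or_imp, forall_and, Set.mem_ofPred_eq,
    forall_exists_index, and_imp, forall_eq_apply_imp_iff, Sat, sat_defined, h₁, h₂]
  constructor
  · rintro ⟨a, ⟨-, b⟩, -, c⟩
    exact ⟨fun x hx => (sat_defined _).1 (a _ x hx rfl), b, c⟩
  · rintro ⟨a, b, c⟩
    exact ⟨fun _ x hx hy => hy ▸ (sat_defined _).2 (a x hx), ⟨fun x d hd => b x d (hle _ d hd), b⟩,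
      fun x d hd => c x d (hle _ d hd), c⟩

/-- If all values of `v` are those of `w`, then any assignment witnessing `τ(s)` agrees with `w` on
the variables of `s`, and by `den_congr` membership in the denotation can be tested on `w`. Both
directions of the reduction to `Truth` use this. -/
theorem true_iff_truth {v : Valuation X' D'} {V : Set X} {w : X → D} {L W M : List (A ⊕ T)}
    (hW : ∀ s, .inr s ∈ L → (w ∈ 𝔗.den s ↔ .inr s ∈ W))
    (hv : ∀ x d, v (e.var (.inr x)) = some d → d = e.val (w x))
    (hM : ∀ a, .inl a ∈ L → (v (e.var (.inl a)) = some e.tt ↔ .inl a ∈ M))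
    (hdef : ∀ s, .inr s ∈ L → ((∀ x ∈ 𝔗.vars s, v (e.var (.inr x)) ≠ none) ↔
      ∀ x ∈ 𝔗.vars s, x ∈ V ∨ ∃ s', .inr s' ∈ M ∧ x ∈ 𝔗.vars s')) {b : A ⊕ T} (hb : b ∈ L) :
    e.True v b ↔ Truth 𝔗 V W M b := by
  cases b with
  | inl a =>
    rw [Truth, ← hM a hb, True, tauAtom, Sat, e.den_reg]
    rfl
  | inr s =>
    rw [Truth, ← hdef s hb, ← hW s hb, True, tauAtom, Sat, e.den_thy]
    constructor
    · rintro ⟨w', hw', h⟩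
      refine ⟨(𝔗.den_congr s w' w fun x hx => ?_).1 hw', fun x hx => by simp [h x hx]⟩
      exact e.val.injective (hv x _ (h x hx))
    · rintro ⟨hw, h⟩
      refine ⟨w, hw, fun x hx => ?_⟩
      obtain ⟨d, hd⟩ := Option.ne_none_iff_exists'.1 (h x hx)
      rw [hd, hv x d hd]

open Classical in
/-- Programs that are not strongly equivalent are distinguished by the interpretations given by three
sublists of a list of their atoms. -/
theorem exists_distinguishing [Nonempty D] (E : Set T) (P Q : List (Rule A T))
    (L : List (A ⊕ T)) (hP : ∀ r ∈ P, ∀ b ∈ r.atoms, b ∈ L) (hQ : ∀ r ∈ Q, ∀ b ∈ r.atoms, b ∈ L)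
    (hne : ¬ e.ProgStronglyEquivalent E {r | r ∈ P} {r | r ∈ Q}) : ∃ pH pK pW : A ⊕ T → Bool,
      (∃ w : X → D, ∀ s, .inr s ∈ L → (w ∈ 𝔗.den s ↔ .inr s ∈ L.filter pW)) ∧
      ¬ (HoldsAll (Truth 𝔗 (𝔗.varsSet E) (L.filter pW) (L.filter pH))
          (Truth 𝔗 (𝔗.varsSet E) (L.filter pW) (L.filter pH ++ L.filter pK)) P ↔
        HoldsAll (Truth 𝔗 (𝔗.varsSet E) (L.filter pW) (L.filter pH))
          (Truth 𝔗 (𝔗.varsSet E) (L.filter pW) (L.filter pH ++ L.filter pK)) Q) := by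
  rw [progStronglyEquivalent_iff] at hne
  push Not at hne
  obtain ⟨h, t, hle, hax, hne⟩ := hne
  rw [models_axioms hle] at hax
  obtain ⟨hE, hX, hA⟩ := hax
  -- The values of `t` are extended to a total assignment; an arbitrary element of `D` serves for
  -- undefined variables.
  have hw : ∀ x, ∃ d : D, ∀ d', t (e.var (.inr x)) = some d' → d' = e.val d := fun x => by
    cases hx : t (e.var (.inr x)) with
    | none => exact ⟨Classical.arbitrary D, by simp⟩
    | some d =>
      obtain ⟨d', rfl⟩ := hX x d hx
      exact ⟨d', by simp⟩
  choose w hw using hw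
  let Def : Valuation X' D' → A ⊕ T → Prop := fun v b => b.elim
    (fun a => v (e.var (.inl a)) = some e.tt) fun s => ∀ x ∈ 𝔗.vars s, v (e.var (.inr x)) ≠ none
  have hDef : ∀ b, Def h b → Def t b := by
    rintro (a | s) hb
    · exact hle _ _ hb
    · intro x hx
      obtain ⟨d, hd⟩ := Option.ne_none_iff_exists'.1 (hb x hx)
      rw [hle _ _ hd]
      simp
  let pW : A ⊕ T → Bool := fun b => b.elim (fun _ => false) fun s => decide (w ∈ 𝔗.den s)
  have hW : ∀ s, .inr s ∈ L → (w ∈ 𝔗.den s ↔ .inr s ∈ L.filter pW) := fun s hs => by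
    simp [pW, hs]
  -- With `M` the atoms of `L` that `v` defines, passing to the least interpretation is harmless: an
  -- atom of `L` all of whose variables are defined is itself in `M`, and conversely external
  -- variables and variables of members of `M` are defined in `v`.
  have key : ∀ (v : Valuation X' D') (M : List (A ⊕ T)), Valuation.Le v t →
      (∀ x ∈ 𝔗.varsSet E, v (e.var (.inr x)) ≠ none) → (∀ b, b ∈ M ↔ b ∈ L ∧ Def v b) →
      ∀ b ∈ L, (e.True v b ↔ Truth 𝔗 (𝔗.varsSet E) (L.filter pW) M b) := by
    intro v M hv hE hM b hb
    refine true_iff_truth hW (fun x d hd => hw x d (hv _ _ hd)) (fun a ha => ?_) (fun s hs => ?_) hb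
    · rw [hM, and_iff_right ha]
      rfl
    · constructor
      · exact fun hd x hx => .inr ⟨s, (hM _).2 ⟨hs, hd⟩, hx⟩
      · intro hd x hx
        rcases hd x hx with hx' | ⟨s', hs', hx'⟩
        · exact hE x hx'
        · exact ((hM _).1 hs').2 x hx'
  have hH := key h (L.filter fun b => decide (Def h b)) hle hE (by simp)
  have hK := key t ((L.filter fun b => decide (Def h b)) ++ L.filter fun b => decide (Def t b))
    (.refl t) (fun x hx => by
      obtain ⟨d, hd⟩ := Option.ne_none_iff_exists'.1 (hE x hx)
      rw [hle _ _ hd]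
      simp) fun b => by
        simp only [List.mem_append, List.mem_filter, decide_eq_true_eq]
        have := hDef b
        tauto
  refine ⟨fun b => decide (Def h b), fun b => decide (Def t b), pW, ⟨w, hW⟩, ?_⟩
  rw [← holdsAll_congr (fun r hr b hb => hH b (hP r hr b hb)) (fun r hr b hb => hK b (hP r hr b hb)),
    ← holdsAll_congr (fun r hr b hb => hH b (hQ r hr b hb)) (fun r hr b hb => hK b (hQ r hr b hb))]
  tauto

open Classical in
/-- Programs that are distinguished by interpretations given by lists of atoms are not strongly
equivalent. -/
theorem not_progStronglyEquivalent (E : Set T) (P Q : List (Rule A T))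
    (L H K W : List (A ⊕ T)) (hP : ∀ r ∈ P, ∀ b ∈ r.atoms, b ∈ L) (hQ : ∀ r ∈ Q, ∀ b ∈ r.atoms, b ∈ L)
    (w : X → D) (hW : ∀ s, .inr s ∈ L → (w ∈ 𝔗.den s ↔ .inr s ∈ W))
    (hne : ¬ (HoldsAll (Truth 𝔗 (𝔗.varsSet E) W H) (Truth 𝔗 (𝔗.varsSet E) W (H ++ K)) P ↔
      HoldsAll (Truth 𝔗 (𝔗.varsSet E) W H) (Truth 𝔗 (𝔗.varsSet E) W (H ++ K)) Q)) :
    ¬ e.ProgStronglyEquivalent E {r | r ∈ P} {r | r ∈ Q} := by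
  rw [progStronglyEquivalent_iff]
  intro hse
  -- The least valuation for `M`, with values taken from `w`. It is monotone in `M`, so `H` and `H
  -- ++ K` yield a pair `h ⊆ t`.
  let val : List (A ⊕ T) → A ⊕ X → Option D' := fun M z => z.elim
    (fun a => if .inl a ∈ M then some e.tt else none)
    (fun x => if x ∈ 𝔗.varsSet E ∨ ∃ s', .inr s' ∈ M ∧ x ∈ 𝔗.vars s' then some (e.val (w x)) else none)
  let v : List (A ⊕ T) → Valuation X' D' := fun M => Function.extend e.var (val M) fun _ => none
  have hvar : ∀ M z, v M (e.var z) = val M z := fun M z => e.var.injective.extend_apply _ _ _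
  have hmono : ∀ M M', M ⊆ M' → Valuation.Le (v M) (v M') := by
    intro M M' hM y d hy
    by_cases hz : ∃ z, e.var z = y
    · obtain ⟨z, rfl⟩ := hz
      rw [hvar] at hy ⊢
      cases z with
      | inl a =>
        simp only [val, Sum.elim_inl, Option.ite_none_right_eq_some] at hy ⊢
        exact ⟨hM hy.1, hy.2⟩
      | inr x =>
        simp only [val, Sum.elim_inr, Option.ite_none_right_eq_some] at hy ⊢
        exact ⟨hy.1.imp id fun ⟨s, hs, hx⟩ => ⟨s, hM hs, hx⟩, hy.2⟩
    · simp only [v, Function.extend_apply' _ _ _ hz] at hy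
      cases hy
  have key : ∀ M : List (A ⊕ T), ∀ b ∈ L,
      (e.True (v M) b ↔ Truth 𝔗 (𝔗.varsSet E) W M b) := by
    intro M b hb
    refine true_iff_truth hW (fun x d hd => ?_) (fun a ha => ?_) (fun s hs => ?_) hb
    · rw [hvar] at hd
      simp only [val, Sum.elim_inr, Option.ite_none_right_eq_some] at hd
      exact (Option.some.inj hd.2).symm
    · simp [hvar, val]
    · simp [hvar, val, or_iff_not_imp_left]
  have hle := hmono H (H ++ K) (by simp)
  refine hne ?_
  rw [← holdsAll_congr (fun r hr b hb => key _ b (hP r hr b hb)) (fun r hr b hb => key _ b (hP r hr b hb)),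
    ← holdsAll_congr (fun r hr b hb => key _ b (hQ r hr b hb)) (fun r hr b hb => key _ b (hQ r hr b hb))]
  refine hse _ _ hle ((models_axioms hle E).2 ⟨fun x hx => ?_, fun x d hd => ?_, fun a d hd => ?_⟩)
  · simp [hvar, val, hx]
  · rw [hvar] at hd
    simp only [val, Sum.elim_inr, Option.ite_none_right_eq_some] at hd
    exact ⟨w x, Option.some.inj hd.2⟩
  · rw [hvar] at hd
    simp only [val, Sum.elim_inl, Option.ite_none_right_eq_some] at hd
    exact (Option.some.inj hd.2).symm

end Encodes

end TProg

namespace Cplx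

/-! ### A small command language over four allStk -/

/-- Symbols on the work allStk; `none` is a separator. -/
abbrev Sym := Option Bool

/-- Contents of the four work allStk. -/
abbrev Regs := Fin 4 → List Sym

/-- Commands. `loop k body last` pops a symbol `x` from stack `k` (`none` if it is empty), executes
`body x`, and repeats this until `last x`. `call i` calls the `i`-th subroutine. -/
inductive Cmd (ι : Type) where
  | skip : Cmd ι
  | push : Fin 4 → Sym → Cmd ι
  | seq : Cmd ι → Cmd ι → Cmd ι
  | loop : Fin 4 → (Option Sym → Cmd ι) → (Option Sym → Bool) → Cmd ι
  | call : ι → Cmd ι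

/-- Input-output behaviour of subroutines: `R i w n w'` means that the `i`-th one
maps `w` to `w'` in `n` steps. -/
abbrev Calls (ι : Type) := ι → List Bool → ℕ → List Bool → Prop

/-- `Exec R c s n s'`: command `c` leads from `s` to `s'` in `n` steps. -/
inductive Exec {ι : Type} (R : Calls ι) : Cmd ι → Regs → ℕ → Regs → Prop
  | skip (s) : Exec R .skip s 1 s
  | push (k x s) : Exec R (.push k x) s 1 (Function.update s k (x :: s k))
  | seq {c₁ c₂ s n s' m s''} : Exec R c₁ s n s' → Exec R c₂ s' m s'' →
      Exec R (.seq c₁ c₂) s (n + m) s''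
  | last {k body last s n s'} : last (s k).head? = true →
      Exec R (body (s k).head?) (Function.update s k (s k).tail) n s' →
      Exec R (.loop k body last) s (n + 1) s'
  | next {k body last s n s' m s''} : last (s k).head? = false →
      Exec R (body (s k).head?) (Function.update s k (s k).tail) n s' →
      Exec R (.loop k body last) s' m s'' →
      Exec R (.loop k body last) s (n + 1 + m) s''
  -- Popping the argument from stack `1` into the subroutine reverses it, and so does unloading the
  -- result to stack `2`. Each transfer takes one step per bit and one to notice the end.
  | call {i w n w' s} : R i w n w' → s 1 = w.reverse.map some → s 2 = [] →
      Exec R (.call i) s (w.length + 1 + n + (w'.length + 1))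
        (Function.update (Function.update s 1 []) 2 (w'.reverse.map some))

/-! ### Compilation of commands -/

section Compile

set_option linter.unusedSectionVars false

open Turing TM2

instance finTM2KFintype (tm : FinTM2) : Fintype tm.K := tm.kFin
instance finTM2LFintype (tm : FinTM2) : Fintype tm.Λ := tm.ΛFin
instance finTM2SFintype (tm : FinTM2) : Fintype tm.σ := tm.σFin

variable {ι : Type} [DecidableEq ι] (tm : ι → TM2ComputableAux Bool Bool)

/-- Stacks of the compiled machine: work allStk, input and oracle stack, allStk of subroutines. -/
abbrev StackIdx : Type := Fin 4 ⊕ Bool ⊕ (Σ i, (tm i).tm.K)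

/-- Alphabets of the compiled machine. -/
abbrev Alphabet : StackIdx tm → Type
  | .inl _ => Sym
  | .inr (.inl _) => Bool
  | .inr (.inr x) => (tm x.1).tm.Γ x.2

/-- Internal memory of the compiled machine. -/
abbrev Memory : Type := Option Sym × (∀ i, (tm i).tm.σ)

/-- The allStk of the compiled machine, from their three groups. -/
def allStk (s : Regs) (io : Bool → List Bool) (u : ∀ i k, List ((tm i).tm.Γ k)) :
    ∀ k, List (Alphabet tm k)
  | .inl k => s k
  | .inr (.inl b) => io b
  | .inr (.inr x) => u x.1 x.2

variable (s : Regs) (io : Bool → List Bool) (u : ∀ i k, List ((tm i).tm.Γ k))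

@[simp] theorem allStk_inl (k) : allStk tm s io u (.inl k) = s k := rfl
@[simp] theorem allStk_inr_inl (b) : allStk tm s io u (.inr (.inl b)) = io b := rfl
@[simp] theorem allStk_inr_inr (i k) : allStk tm s io u (.inr (.inr ⟨i, k⟩)) = u i k := rfl

@[simp] theorem update_allStk_inl (k) (x : List Sym) :
    Function.update (allStk tm s io u) (.inl k) x = allStk tm (Function.update s k x) io u := by
  funext j
  rcases j with j | j | j
  · by_cases h : j = k
    · subst h; simp
    · simp [Function.update_of_ne, h]
  · simp
  · simp [allStk]

@[simp] theorem update_allStk_inr_inl (b) (x : List Bool) :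
    Function.update (allStk tm s io u) (.inr (.inl b)) x =
      allStk tm s (Function.update io b x) u := by
  funext j
  rcases j with j | j | j
  · simp
  · by_cases h : j = b
    · subst h; simp
    · simp [Function.update_of_ne, h]
  · simp [allStk]

@[simp] theorem update_allStk_inr_inr (i k) (x : List ((tm i).tm.Γ k)) :
    Function.update (allStk tm s io u) (.inr (.inr ⟨i, k⟩)) x =
      allStk tm s io (Function.update u i (Function.update (u i) k x)) := by
  funext j
  rcases j with j | j | ⟨i', k'⟩
  · simp
  · simp
  · by_cases h : i' = i
    · subst h
      by_cases h' : k' = k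
      · subst h'; simp
      · simp [Function.update_of_ne, h']
    · rw [Function.update_of_ne (by simp [h])]
      simp [Function.update_of_ne h]

variable {tm s io u}

/-- A statement of the `i`-th subroutine as a statement of the compiled machine,
returning to `ret`. -/
def liftStmt {Λ : Type} (i : ι) (emb : (tm i).tm.Λ → Λ) (ret : Λ) :
    Stmt (tm i).tm.Γ (tm i).tm.Λ (tm i).tm.σ → Stmt (Alphabet tm) Λ (Memory tm)
  | .push k f q => .push (.inr (.inr ⟨i, k⟩)) (fun v => f (v.2 i)) (liftStmt i emb ret q)
  | .peek k f q => .peek (.inr (.inr ⟨i, k⟩))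
      (fun v x => (v.1, Function.update v.2 i (f (v.2 i) x))) (liftStmt i emb ret q)
  | .pop k f q => .pop (.inr (.inr ⟨i, k⟩))
      (fun v x => (v.1, Function.update v.2 i (f (v.2 i) x))) (liftStmt i emb ret q)
  | .load f q => .load (fun v => (v.1, Function.update v.2 i (f (v.2 i)))) (liftStmt i emb ret q)
  | .branch f q₁ q₂ => .branch (fun v => f (v.2 i)) (liftStmt i emb ret q₁) (liftStmt i emb ret q₂)
  | .goto f => .goto fun v => emb (f (v.2 i))
  | .halt => .goto fun _ => ret

theorem stepAux_liftStmt {Λ : Type} (i : ι) (emb : (tm i).tm.Λ → Λ) (ret : Λ)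
    (q : Stmt (tm i).tm.Γ (tm i).tm.Λ (tm i).tm.σ) (x : Option Sym) (v : ∀ i, (tm i).tm.σ)
    (u : ∀ i k, List ((tm i).tm.Γ k)) :
    stepAux (liftStmt i emb ret q) (x, v) (allStk tm s io u) =
      ⟨some (((stepAux q (v i) (u i)).l).elim ret emb),
        (x, Function.update v i (stepAux q (v i) (u i)).var),
        allStk tm s io (Function.update u i (stepAux q (v i) (u i)).stk)⟩ := by
  induction q generalizing v u with
  | push k f q ih => simp [liftStmt, ih]
  | peek k f q ih => simp [liftStmt, ih]
  | pop k f q ih => simp [liftStmt, ih]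
  | load f q ih => simp [liftStmt, ih]
  | branch f q₁ q₂ ih₁ ih₂ => cases h : f (v i) <;> simp [liftStmt, h, ih₁, ih₂]
  | goto f => simp [liftStmt]
  | halt => simp [liftStmt]

variable (tm)

/-- Labels of the compiled command. -/
inductive Lab : Cmd ι → Type
  | skip : Lab .skip
  | push {k x} : Lab (.push k x)
  | left {c₁ c₂} : Lab c₁ → Lab (.seq c₁ c₂)
  | right {c₁ c₂} : Lab c₂ → Lab (.seq c₁ c₂)
  | pop {k body last} : Lab (.loop k body last)
  | body {k body last} (x) : Lab (body x) → Lab (.loop k body last)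
  | callIn {i} : Lab (.call i)
  | callOut {i} : Lab (.call i)
  | callRun {i} : (tm i).tm.Λ → Lab (.call i)

/-- `FinTM2` requires finitely many labels. A loop has one copy of its body for each possible popped
symbol, and there are finitely many of these. -/
theorem finite_lab (c : Cmd ι) : Finite (Lab tm c) := by
  induction c with
  | skip => exact Finite.of_surjective (fun _ : Unit => .skip) fun l => by cases l; exact ⟨(), rfl⟩
  | push k x => exact Finite.of_surjective (fun _ : Unit => .push) fun l => by cases l; exact ⟨(), rfl⟩
  | seq c₁ c₂ ih₁ ih₂ =>
    refine Finite.of_surjective (Sum.elim Lab.left Lab.right) fun l => ?_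
    cases l with
    | left l => exact ⟨.inl l, rfl⟩
    | right l => exact ⟨.inr l, rfl⟩
  | loop k body last ih =>
    refine Finite.of_surjective (fun o : Option (Σ x, Lab tm (body x)) =>
      o.elim Lab.pop fun y => Lab.body y.1 y.2) fun l => ?_
    cases l with
    | pop => exact ⟨none, rfl⟩
    | body x l => exact ⟨some ⟨x, l⟩, rfl⟩
  | call i =>
    refine Finite.of_surjective (fun o : Bool ⊕ (tm i).tm.Λ =>
      o.elim (fun b => cond b Lab.callOut Lab.callIn) Lab.callRun) fun l => ?_
    cases l with
    | callIn => exact ⟨.inl false, rfl⟩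
    | callOut => exact ⟨.inl true, rfl⟩
    | callRun l => exact ⟨.inr l, rfl⟩

/-- First label of the compiled command. -/
def entry : ∀ c : Cmd ι, Lab tm c
  | .skip => .skip
  | .push _ _ => .push
  | .seq c₁ _ => .left (entry c₁)
  | .loop _ _ _ => .pop
  | .call _ => .callIn

/-- The compiled command, inside a machine with labels `Λ`, with exit to the label `ex`. -/
def compile {Λ : Type} : ∀ c : Cmd ι, (Lab tm c → Λ) → Λ → Lab tm c →
    Stmt (Alphabet tm) Λ (Memory tm)
  | .skip, _, ex, _ => .goto fun _ => ex
  | .push k x, _, ex, _ => .push (.inl k) (fun _ => x) (.goto fun _ => ex)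
  | .seq c₁ c₂, emb, _, .left l =>
    compile c₁ (fun l => emb (.left l)) (emb (.right (entry tm c₂))) l
  | .seq _ c₂, emb, ex, .right l => compile c₂ (fun l => emb (.right l)) ex l
  | .loop k body _, emb, _, .pop =>
    .pop (.inl k) (fun v x => (x, v.2)) (.goto fun v => emb (.body v.1 (entry tm (body v.1))))
  | .loop _ body last, emb, ex, .body x l =>
    compile (body x) (fun l => emb (.body x l)) (if last x then ex else emb .pop) l
  | .call i, emb, _, .callIn =>
    .pop (.inl 1) (fun v x => (x, v.2)) (.branch (fun v => v.1.isSome)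
      (.push (.inr (.inr ⟨i, (tm i).tm.k₀⟩))
        (fun v => (tm i).inputAlphabet.symm (v.1.join.getD false))
        (.goto fun _ => emb .callIn))
      (.goto fun _ => emb (.callRun (tm i).tm.main)))
  | .call i, emb, ex, .callOut =>
    .pop (.inr (.inr ⟨i, (tm i).tm.k₁⟩)) (fun v x => (x.map fun y => some ((tm i).outputAlphabet y), v.2))
      (.branch (fun v => v.1.isSome)
        (.push (.inl 2) (fun v => v.1.join) (.goto fun _ => emb .callOut))
        (.goto fun _ => ex))
  | .call i, emb, _, .callRun l =>
    liftStmt i (fun l => emb (.callRun l)) (emb .callOut) ((tm i).tm.m l)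

variable {tm}

/-- A run of exactly `n` steps of the program `m` in which all visited labels, except possibly
the last one, are in `G`. -/
inductive DRun {K Λ σ : Type} [DecidableEq K] {Γ : K → Type} (m : Λ → Stmt Γ Λ σ) (G : Λ → Prop) :
    ℕ → Cfg Γ Λ σ → Cfg Γ Λ σ → Prop
  | refl (c) : DRun m G 0 c c
  | head {l v S n c} : G l → DRun m G n (stepAux (m l) v S) c → DRun m G (n + 1) ⟨some l, v, S⟩ c

theorem DRun.trans {K Λ σ : Type} [DecidableEq K] {Γ : K → Type} {m : Λ → Stmt Γ Λ σ}
    {G : Λ → Prop} {n n' : ℕ} {c c' c'' : Cfg Γ Λ σ} (h : DRun m G n c c')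
    (h' : DRun m G n' c' c'') : DRun m G (n + n') c c'' := by
  induction h with
  | refl => simpa using h'
  | head hl _ ih => rw [Nat.add_right_comm]; exact .head hl (ih h')

variable (tm) in
/-- The behaviour of the given subroutines. -/
def behaviour : Calls ι := fun i w n w' =>
  (flip bind (tm i).tm.step)^[n] (some (initList (tm i).tm (w.map (tm i).inputAlphabet.invFun))) =
    some (haltList (tm i).tm (w'.map (tm i).outputAlphabet.invFun))

variable (tm) in
/-- The internal memory between calls of subroutines. -/
def memory (x : Option Sym) : Memory tm := (x, fun i => (tm i).tm.initialState)

variable (tm) in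
/-- The allStk between calls of subroutines. -/
def idle (s : Regs) (io : Bool → List Bool) : ∀ k, List (Alphabet tm k) :=
  allStk tm s io fun _ _ => []

theorem initList_stk (tm : FinTM2) (l : List (tm.Γ tm.k₀)) :
    (initList tm l).stk = Function.update (fun _ => []) tm.k₀ l := by
  funext k
  by_cases h : k = tm.k₀
  · subst h; simp [initList]
  · simp [initList, h]

theorem haltList_stk (tm : FinTM2) (l : List (tm.Γ tm.k₁)) :
    (haltList tm l).stk = Function.update (fun _ => []) tm.k₁ l := by
  funext k
  by_cases h : k = tm.k₁
  · subst h; simp [haltList]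
  · simp [haltList, h]

theorem iterate_flip_bind_none {α : Type*} (f : α → Option α) (n : ℕ) :
    (flip bind f)^[n] none = none := by
  induction n with
  | zero => rfl
  | succ n ih => rw [Function.iterate_succ_apply]; exact ih

/-! ### Correctness of the compilation -/

section

variable {Λ : Type} {m : Λ → Stmt (Alphabet tm) Λ (Memory tm)} {G : Λ → Prop}

/-- Each step of the subroutine is one step of the lifted program, and its halting becomes a jump to
`ret`. Stepping a halted configuration gives `none` forever, so a run that yields `some c'` after
`n` steps did not halt earlier. -/
theorem DRun.subroutine {i : ι} {emb : (tm i).tm.Λ → Λ} {ret : Λ}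
    (hm : ∀ l, m (emb l) = liftStmt i emb ret ((tm i).tm.m l)) (hG : ∀ l, G (emb l))
    (x : Option Sym) (n : ℕ) (c c' : Cfg (tm i).tm.Γ (tm i).tm.Λ (tm i).tm.σ)
    (v : ∀ i, (tm i).tm.σ) (u : ∀ i k, List ((tm i).tm.Γ k)) (hc' : c'.l = none)
    (h : (flip bind (tm i).tm.step)^[n] (some c) = some c') :
    DRun m G n
      ⟨some (c.l.elim ret emb), (x, Function.update v i c.var),
        allStk tm s io (Function.update u i c.stk)⟩
      ⟨some ret, (x, Function.update v i c'.var), allStk tm s io (Function.update u i c'.stk)⟩ := by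
  induction n generalizing c with
  | zero =>
    cases Option.some.inj h
    rw [hc']
    exact .refl _
  | succ n ih =>
    rw [Function.iterate_succ_apply] at h
    obtain ⟨l, w, S⟩ := c
    cases l with
    | none =>
      have : flip bind (tm i).tm.step (some ⟨none, w, S⟩) = none := rfl
      rw [this, iterate_flip_bind_none] at h
      cases h
    | some l =>
      have := ih _ h
      refine .head (hG l) ?_
      change DRun m G n (stepAux (m (emb l)) (x, Function.update v i w)
        (allStk tm s io (Function.update u i S))) _
      rw [hm, stepAux_liftStmt]
      simpa using this

/-- The invariant has a parameter `y`: the bits that have been transferred already, below which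
nothing else lies. -/
theorem DRun.callIn {i : ι} {emb : Lab tm (.call i) → Λ} {ex : Λ}
    (hm : ∀ l, m (emb l) = compile tm (.call i) emb ex l) (hG : ∀ l, G (emb l))
    (w : List Bool) (x : Option Sym) (v : ∀ i, (tm i).tm.σ) (y : List ((tm i).tm.Γ (tm i).tm.k₀))
    (s : Regs) (hs : s 1 = w.map some) :
    DRun m G (w.length + 1)
      ⟨some (emb .callIn), (x, v),
        allStk tm s io (Function.update (fun _ _ => []) i (Function.update (fun _ => []) _ y))⟩
      ⟨some (emb (.callRun (tm i).tm.main)), (none, v),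
        allStk tm (Function.update s 1 []) io (Function.update (fun _ _ => []) i
          (Function.update (fun _ => []) _ (w.reverse.map (tm i).inputAlphabet.invFun ++ y)))⟩ := by
  induction w generalizing x y s with
  | nil =>
    refine .head (hG _) ?_
    rw [hm]
    simp only [compile, stepAux, allStk_inl, hs]
    simp
    exact .refl _
  | cons b w ih =>
    refine .head (hG _) ?_
    rw [hm]
    have := ih (some (some b)) ((tm i).inputAlphabet.symm b :: y) (Function.update s 1 (w.map some))
      (by simp)
    simp only [compile, stepAux, allStk_inl, hs]
    simpa using this

theorem DRun.callOut {i : ι} {emb : Lab tm (.call i) → Λ} {ex : Λ}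
    (hm : ∀ l, m (emb l) = compile tm (.call i) emb ex l) (hG : ∀ l, G (emb l))
    (w : List Bool) (x : Option Sym) (v : ∀ i, (tm i).tm.σ) (s : Regs) :
    DRun m G (w.length + 1)
      ⟨some (emb .callOut), (x, v),
        allStk tm s io (Function.update (fun _ _ => []) i
          (Function.update (fun _ => []) _ (w.map (tm i).outputAlphabet.invFun)))⟩
      ⟨some ex, (none, v),
        allStk tm (Function.update s 2 (w.reverse.map some ++ s 2)) io (fun _ _ => [])⟩ := by
  induction w generalizing x s with
  | nil =>
    refine .head (hG _) ?_
    rw [hm]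
    simp only [compile, stepAux]
    simp
    exact .refl _
  | cons b w ih =>
    refine .head (hG _) ?_
    rw [hm]
    have := ih (some (some b)) (Function.update s 2 (some b :: s 2))
    simp only [compile, stepAux]
    simpa using this

/-- Compiled commands do what the commands do. -/
theorem Exec.dRun {c : Cmd ι} {s s' : Regs} {n : ℕ} (h : Exec (behaviour tm) c s n s')
    (emb : Lab tm c → Λ) (ex : Λ) (hm : ∀ l, m (emb l) = compile tm c emb ex l)
    (hG : ∀ l, G (emb l)) (x : Option Sym) :
    ∃ x', DRun m G n ⟨some (emb (entry tm c)), memory tm x, idle tm s io⟩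
      ⟨some ex, memory tm x', idle tm s' io⟩ := by
  induction h generalizing x ex with
  | skip s =>
    refine ⟨x, .head (hG _) ?_⟩
    rw [hm]
    exact .refl _
  | push k y s =>
    refine ⟨x, .head (hG _) ?_⟩
    rw [hm]
    simp only [compile, stepAux, idle, update_allStk_inl, allStk_inl]
    exact .refl _
  | seq _ _ ih₁ ih₂ =>
    obtain ⟨x₁, h₁⟩ := ih₁ (fun l => emb (.left l)) (emb (.right (entry tm _)))
      (fun l => by rw [hm]; rfl) (fun l => hG _) x
    obtain ⟨x₂, h₂⟩ := ih₂ (fun l => emb (.right l)) ex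
      (fun l => by rw [hm]; rfl) (fun l => hG _) x₁
    exact ⟨x₂, h₁.trans h₂⟩
  | @last k body last s n s' hst _ ih =>
    obtain ⟨x₁, h₁⟩ := ih (fun l => emb (.body _ l)) ex
      (fun l => by rw [hm, compile, if_pos hst]) (fun l => hG _) (s k).head?
    refine ⟨x₁, .head (hG _) ?_⟩
    rw [entry, hm]
    simp only [compile, stepAux, idle, update_allStk_inl, allStk_inl]
    exact h₁
  | @next k body last s n s' m s'' hst _ _ ih ih' =>
    obtain ⟨x₁, h₁⟩ := ih (fun l => emb (.body _ l)) (emb .pop)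
      (fun l => by rw [hm, compile, if_neg (by simp [hst])]) (fun l => hG _) (s k).head?
    obtain ⟨x₂, h₂⟩ := ih' emb ex hm hG x₁
    refine ⟨x₂, DRun.trans (.head (hG _) ?_) h₂⟩
    rw [entry, hm]
    simp only [compile, stepAux, idle, update_allStk_inl, allStk_inl]
    exact h₁
  | @call i w n w' s hR h₁ h₂ =>
    -- Load, run, unload. A halting configuration `haltList` has the initial memory and all stacks
    -- empty except for the output, so after unloading the subroutine is ready for another call.
    refine ⟨none, (DRun.trans ?_ (DRun.subroutine (s := Function.update s 1 []) (io := io) (emb := fun l => emb (.callRun l)) (ret := emb .callOut)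
      (fun l => by rw [hm, compile]) (fun l => hG _) none n _ _
      (fun i => (tm i).tm.initialState) (fun _ _ => []) rfl hR)).trans ?_⟩
    · have := DRun.callIn (m := m) (G := G) hm hG w.reverse x (fun i => (tm i).tm.initialState)
        [] s h₁ (io := io)
      simp only [List.length_reverse, List.reverse_reverse, List.append_nil] at this
      convert this using 2
      · rfl
      · rfl
      · simp [idle]
      · rfl
      · exact Prod.ext rfl (Function.update_eq_self i _)
      · exact congrArg (fun y => allStk tm _ io (Function.update _ i y)) (initList_stk _ _)
    · have := DRun.callOut (m := m) (G := G) hm hG w' none (fun i => (tm i).tm.initialState)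
        (Function.update s 1 []) (io := io)
      convert this using 2
      · exact Prod.ext rfl (Function.update_eq_self i _)
      · exact congrArg (fun y => allStk tm _ io (Function.update _ i y)) (haltList_stk _ _)
      · rfl
      · simp [idle, h₂]

end

/-! ### Nondeterministic oracle machines that guess, compute and query -/

section Outcome

variable {M : OracleNTM} {O : Set (List Bool)}

theorem OracleNTM.Run.head {n : ℕ} {c c' c'' : M.Config} (h : M.Step O c c')
    (h' : M.Run O n c' c'') : M.Run O (n + 1) c c'' := by
  induction h' with
  | refl => exact .tail (.refl _) h
  | tail _ hs ih => exact .tail (ih h) hs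

theorem OracleNTM.Run.cases_head {n : ℕ} {c c'' : M.Config} (h : M.Run O n c c'') :
    (n = 0 ∧ c = c'') ∨ ∃ k c', n = k + 1 ∧ M.Step O c c' ∧ M.Run O k c' c'' := by
  induction h with
  | refl => exact .inl ⟨rfl, rfl⟩
  | @tail n c c' c'' _ hs ih =>
    rcases ih with ⟨rfl, rfl⟩ | ⟨k, d, rfl, h₁, h₂⟩
    · exact .inr ⟨0, _, rfl, hs, .refl _⟩
    · exact .inr ⟨k + 1, d, rfl, h₁, .tail h₂ hs⟩

variable (M O) in
/-- All computation paths from `c` have length at most `b`, and some path accepts iff `P`. -/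
def Outcome (c : M.Config) (b : ℕ) (P : Prop) : Prop :=
  (∀ n c', M.Run O n c c' → n ≤ b) ∧ ((∃ n c', M.Run O n c c' ∧ c'.l = some M.accept) ↔ P)

theorem Outcome.mono {c : M.Config} {b b' : ℕ} {P Q : Prop} (h : Outcome M O c b P) (hb : b ≤ b')
    (hP : P ↔ Q) : Outcome M O c b' Q :=
  ⟨fun n c' hr => (h.1 n c' hr).trans hb, h.2.trans hP⟩

/-- One-sided conditions on the successors serve both for a nondeterministic step, where two
transitions are available, and for a query, where the answer determines the successor. -/
theorem Outcome.of_steps {c : M.Config} {b : ℕ} {P : Prop} (hacc : c.l ≠ some M.accept)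
    (h₁ : ∀ c', M.Step O c c' → ∃ Q, Outcome M O c' b Q ∧ (Q → P))
    (h₂ : P → ∃ c', M.Step O c c' ∧ Outcome M O c' b True) : Outcome M O c (b + 1) P := by
  refine ⟨fun n c' hr => ?_, ?_, fun hP => ?_⟩
  · rcases hr.cases_head with ⟨rfl, -⟩ | ⟨k, d, rfl, hs, hr'⟩
    · omega
    · obtain ⟨Q, hQ, -⟩ := h₁ d hs
      have := hQ.1 _ _ hr'
      omega
  · rintro ⟨n, c', hr, hc'⟩
    rcases hr.cases_head with ⟨rfl, rfl⟩ | ⟨k, d, rfl, hs, hr'⟩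
    · exact absurd hc' hacc
    · obtain ⟨Q, hQ, hQP⟩ := h₁ d hs
      exact hQP (hQ.2.1 ⟨_, _, hr', hc'⟩)
  · obtain ⟨c', hs, hc'⟩ := h₂ hP
    obtain ⟨n, d, hr, hd⟩ := hc'.2.2 trivial
    exact ⟨_, d, .head hs hr, hd⟩

theorem Outcome.branch {l : M.tm.Λ} {v : M.tm.σ} {S : ∀ k, List (M.tm.Γ k)} {b : ℕ} {P Q : Prop}
    (ha : l ≠ M.accept) (hq : l ≠ M.query) (h₁ : Outcome M O (stepAux (M.tm.m l) v S) b P)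
    (h₂ : Outcome M O (stepAux (M.m' l) v S) b Q) : Outcome M O ⟨some l, v, S⟩ (b + 1) (P ∨ Q) := by
  refine .of_steps (by simpa using ha) (fun c' hs => ?_) ?_
  · cases hs with
    | fst => exact ⟨P, h₁, .inl⟩
    | snd => exact ⟨Q, h₂, .inr⟩
    | yes => exact absurd rfl hq
    | no => exact absurd rfl hq
  · rintro (hP | hQ)
    · exact ⟨_, .fst l v S ha hq, h₁.mono le_rfl (by simpa)⟩
    · exact ⟨_, .snd l v S ha hq, h₂.mono le_rfl (by simpa)⟩

theorem Outcome.branch_eq {l : M.tm.Λ} {v : M.tm.σ} {S : ∀ k, List (M.tm.Γ k)} {b : ℕ} {P Q : Prop}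
    (ha : l ≠ M.accept) (hq : l ≠ M.query) {c₁ c₂ : M.Config} (e₁ : stepAux (M.tm.m l) v S = c₁)
    (e₂ : stepAux (M.m' l) v S = c₂) (h₁ : Outcome M O c₁ b P) (h₂ : Outcome M O c₂ b Q) :
    Outcome M O ⟨some l, v, S⟩ (b + 1) (P ∨ Q) :=
  .branch ha hq (e₁ ▸ h₁) (e₂ ▸ h₂)

/-- Where the two transition functions agree, the nondeterministic choice is between equal
successors. -/
theorem Outcome.dRun {G : M.tm.Λ → Prop} (hG : ∀ l, G l → l ≠ M.accept ∧ l ≠ M.query ∧ M.m' l = M.tm.m l)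
    {n b : ℕ} {c c' : M.Config} {P : Prop} (h : DRun M.tm.m G n c c') (hc' : Outcome M O c' b P) :
    Outcome M O c (n + b) P := by
  induction h with
  | refl => exact hc'.mono (by omega) Iff.rfl
  | @head l v S n c hl _ ih =>
    obtain ⟨h₁, h₂, h₃⟩ := hG l hl
    exact (Outcome.branch h₁ h₂ (ih hc') (by rw [h₃]; exact ih hc')).mono (by omega) (or_self_iff)

theorem Outcome.halted {c : M.Config} (hc : c.l = none) (b : ℕ) : Outcome M O c b False := by
  have key : ∀ n c', M.Run O n c c' → n = 0 ∧ c = c' := fun n c' hr => by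
    rcases hr.cases_head with h | ⟨k, d, rfl, hs, hr'⟩
    · exact h
    · cases hs <;> simp at hc
  refine ⟨fun n c' hr => by have := (key n c' hr).1; omega, ?_, False.elim⟩
  rintro ⟨n, c', hr, hc'⟩
  obtain ⟨rfl, rfl⟩ := key n c' hr
  rw [hc] at hc'
  cases hc'

theorem Outcome.accepting {c : M.Config} (hc : c.l = some M.accept) (b : ℕ) :
    Outcome M O c b True := by
  refine ⟨fun n c' hr => ?_, fun _ => trivial, fun _ => ⟨0, c, .refl _, hc⟩⟩
  rcases hr.cases_head with ⟨rfl, -⟩ | ⟨k, d, rfl, hs, hr'⟩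
  · omega
  · cases hs <;> simp_all

end Outcome

/-! ### The machine that guesses, computes and queries -/

section Machine

variable [Fintype ι] (tm) (c : Cmd ι)

/-- The program of the machine that guesses a word as long as the input, executes `c` and asks
one oracle query; the bit `g` is the one that is guessed. -/
def guessProgram (g : Bool) : Lab tm c ⊕ Fin 6 → Stmt (Alphabet tm) (Lab tm c ⊕ Fin 6) (Memory tm)
  -- The extra labels: `0` guesses, `1` tests the computed bit, `2` moves the query to the oracle
  -- tape, `3` queries, `4` is both the positive answer and acceptance, `5` is the negative answer
  -- and halts. Only label `0` depends on `g`.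
  | .inl l => compile tm c Sum.inl (.inr 1) l
  | .inr 0 => .pop (.inr (.inl false)) (fun v x => (x.map some, v.2)) (.branch (fun v => v.1.isSome)
      (.push (.inl 1) (fun v => v.1.join) (.push (.inl 2) (fun _ => some g)
        (.goto fun _ => .inr 0)))
      (.goto fun _ => .inl (entry tm c)))
  | .inr 1 => .pop (.inl 0) (fun v x => (x, v.2)) (.branch (fun v => v.1 == some (some true))
      (.goto fun _ => .inr 2) .halt)
  | .inr 2 => .pop (.inl 1) (fun v x => (x, v.2)) (.branch (fun v => v.1.isSome)
      (.push (.inr (.inl true)) (fun v => v.1.join.getD false) (.goto fun _ => .inr 2))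
      (.goto fun _ => .inr 3))
  | .inr _ => .halt

/-- The machine that guesses a word as long as the input, executes `c` and asks one oracle query. -/
noncomputable def guessMachine : OracleNTM where
  tm :=
    { K := StackIdx tm
      k₀ := .inr (.inl false)
      k₁ := .inr (.inl true)
      Γ := Alphabet tm
      Λ := Lab tm c ⊕ Fin 6
      main := .inr 0
      ΛFin := haveI := finite_lab tm c; Fintype.ofFinite _
      σ := Memory tm
      initialState := memory tm none
      Γk₀Fin := inferInstanceAs (Fintype Bool)
      m := guessProgram tm c false }
  m' := guessProgram tm c true
  inBit := Equiv.refl Bool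
  queryBit := Equiv.refl Bool
  query := .inr 3
  yes := .inr 4
  no := .inr 5
  accept := .inr 4

/-- Input and oracle stack. -/
def ioStk (w y : List Bool) : Bool → List Bool := fun b => cond b y w

@[simp] theorem ioStk_false (w y) : ioStk w y false = w := rfl
@[simp] theorem ioStk_true (w y) : ioStk w y true = y := rfl

@[simp] theorem update_ioStk_false (w y z) : Function.update (ioStk w y) false z = ioStk z y := by
  funext b; cases b <;> simp [ioStk]

@[simp] theorem update_ioStk_true (w y z) : Function.update (ioStk w y) true z = ioStk w z := by
  funext b; cases b <;> simp [ioStk]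

/-- The contents of the four work stacks. -/
def regs (x y z t : List Sym) : Regs := ![x, y, z, t]

section
variable (x y z t w : List Sym)
@[simp] theorem regs_zero : regs x y z t 0 = x := rfl
@[simp] theorem regs_one : regs x y z t 1 = y := rfl
@[simp] theorem regs_two : regs x y z t 2 = z := rfl
@[simp] theorem regs_three : regs x y z t 3 = t := rfl
@[simp] theorem update_regs_zero : Function.update (regs x y z t) 0 w = regs w y z t := by
  funext i; fin_cases i <;> rfl
@[simp] theorem update_regs_one : Function.update (regs x y z t) 1 w = regs x w z t := by
  funext i; fin_cases i <;> rfl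
@[simp] theorem update_regs_two : Function.update (regs x y z t) 2 w = regs x y w t := by
  funext i; fin_cases i <;> rfl
@[simp] theorem update_regs_three : Function.update (regs x y z t) 3 w = regs x y z w := by
  funext i; fin_cases i <;> rfl
end

variable {tm c} {O : Set (List Bool)}

/-- Induction on the input, which serves as a clock: each input bit is paid for by one guessed bit.
The bit guessed first ends up lowest on stack `2`, so the induction hypothesis is applied to `fun g
=> P (g ++ [t])`. -/
theorem outcome_guess (w : List Bool) (b : ℕ) (P : List Bool → Prop) (x : Option Sym)
    (y z : List Sym)
    (h : ∀ g : List Bool, g.length = w.length → Outcome (guessMachine tm c) O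
      ⟨some (.inl (entry tm c)), memory tm none,
        idle tm (regs [] (w.reverse.map some ++ y) (g.map some ++ z) []) (ioStk [] [])⟩ b (P g)) :
    Outcome (guessMachine tm c) O
      ⟨some (.inr 0), memory tm x, idle tm (regs [] y z []) (ioStk w [])⟩ (w.length + 1 + b)
      (∃ g, g.length = w.length ∧ P g) := by
  induction w generalizing x y z P with
  | nil =>
    have h0 := h [] rfl
    simp only [List.reverse_nil, List.map_nil, List.nil_append] at h0
    have hstep : ∀ t, stepAux (guessProgram tm c t (.inr 0)) (memory tm x)
        (idle tm (regs [] y z []) (ioStk [] [])) =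
        ⟨some (.inl (entry tm c)), memory tm none, idle tm (regs [] y z []) (ioStk [] [])⟩ :=
      fun t => by simp [guessProgram, idle, memory]
    refine (Outcome.branch_eq ?_ ?_ (hstep false) (hstep true) h0 h0).mono (by simp) (by simp)
    · simp [guessMachine]
    · simp [guessMachine]
  | cons a w ih =>
    have key : ∀ t : Bool, Outcome (guessMachine tm c) O
        ⟨some (.inr 0), memory tm (some (some a)),
          idle tm (regs [] (some a :: y) (some t :: z) []) (ioStk w [])⟩ (w.length + 1 + b)
        (∃ g, g.length = w.length ∧ P (g ++ [t])) := fun t =>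
      ih (fun g => P (g ++ [t])) (some (some a)) (some a :: y) (some t :: z) fun g hg => by
        have := h (g ++ [t]) (by simp [hg])
        simp only [List.reverse_cons, List.map_append, List.map_cons, List.map_nil,
          List.append_assoc, List.singleton_append] at this
        exact this
    have hstep : ∀ t, stepAux (guessProgram tm c t (.inr 0)) (memory tm x)
        (idle tm (regs [] y z []) (ioStk (a :: w) [])) = ⟨some (.inr 0), memory tm (some (some a)),
          idle tm (regs [] (some a :: y) (some t :: z) []) (ioStk w [])⟩ :=
      fun t => by simp [guessProgram, idle, memory]
    refine (Outcome.branch_eq ?_ ?_ (hstep false) (hstep true) (key false) (key true)).mono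
      (by simp) ?_
    · simp [guessMachine]
    · simp [guessMachine]
    · constructor
      · rintro (⟨g, hg, hP⟩ | ⟨g, hg, hP⟩)
        · exact ⟨_, by simp [hg], hP⟩
        · exact ⟨_, by simp [hg], hP⟩
      · rintro ⟨g, hg, hP⟩
        rcases List.eq_nil_or_concat g with rfl | ⟨g, t, rfl⟩
        · simp at hg
        · cases t
          · exact .inl ⟨g, by simpa using hg, by simpa using hP⟩
          · exact .inr ⟨g, by simpa using hg, by simpa using hP⟩

theorem outcome_ask (w y : List Bool) (x : Option Sym) (s : Regs) (hs : s 1 = w.map some) :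
    Outcome (guessMachine tm c) O
      ⟨some (.inr 2), memory tm x, idle tm s (ioStk [] y)⟩ (w.length + 3) (w.reverse ++ y ∈ O) := by
  induction w generalizing x y s with
  | nil =>
    -- Two steps suffice: the query, and the step that halts after a negative answer.
    have key : Outcome (guessMachine tm c) O
        ⟨some (.inr 3), memory tm none, idle tm s (ioStk [] y)⟩ 2 (y ∈ O) := by
      refine .of_steps (by simp [guessMachine]) (fun c' hs => ?_) fun hy => ?_
      · have hquery : ∀ l : Lab tm c ⊕ Fin 6, l = .inr 3 → l ≠ (guessMachine tm c).query → False :=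
          fun l hl h => h hl
        generalize hc : (⟨some (.inr 3), memory tm none, idle tm s (ioStk [] y)⟩ :
          (guessMachine tm c).Config) = c₀ at hs
        cases hs with
        | fst l v S h₁ h₂ => cases hc; exact absurd rfl h₂
        | snd l v S h₁ h₂ => cases hc; exact absurd rfl h₂
        | yes v S h₁ h₂ =>
          cases hc
          exact ⟨True, .accepting rfl _, fun _ => by
            have h₃ : List.map id y ∈ O := h₂
            rwa [List.map_id] at h₃⟩
        | no v S h₁ h₂ =>
          refine ⟨False, ?_, False.elim⟩
          refine (Outcome.branch (b := 0) (P := False) (Q := False) ?_ ?_ (.halted rfl _)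
            (.halted rfl _)).mono le_rfl (by simp)
          · simp [guessMachine]
          · simp [guessMachine]
      · exact ⟨_, .yes _ _ (by simp [guessMachine]) (by
          change List.map id y ∈ O
          rwa [List.map_id]),
          .accepting rfl _⟩
    have hstep : ∀ t, stepAux (guessProgram tm c t (.inr 2)) (memory tm x) (idle tm s (ioStk [] y)) =
        ⟨some (.inr 3), memory tm none, idle tm s (ioStk [] y)⟩ := fun t => by
      have : Function.update s 1 [] = s := by rw [← Function.update_eq_self 1 s, hs]; simp
      simp [guessProgram, idle, memory, hs, this]
    refine (Outcome.branch_eq ?_ ?_ (hstep false) (hstep true) key key).mono le_rfl (by simp)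
    · simp [guessMachine]
    · simp [guessMachine]
  | cons a w ih =>
    have key := ih (a :: y) (some (some a)) (Function.update s 1 (w.map some)) (by simp)
    have hstep : ∀ t, stepAux (guessProgram tm c t (.inr 2)) (memory tm x) (idle tm s (ioStk [] y)) =
        ⟨some (.inr 2), memory tm (some (some a)),
          idle tm (Function.update s 1 (w.map some)) (ioStk [] (a :: y))⟩ := fun t => by
      simp [guessProgram, idle, memory, hs]
    refine (Outcome.branch_eq ?_ ?_ (hstep false) (hstep true) key key).mono
      (by simp) (by simp)
    · simp [guessMachine]
    · simp [guessMachine]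

/-- A problem is in `NP` with oracle `O` if its positive instances have certificates, as long as the
instance, such that a command computes from instance and certificate in polynomial time a bit, which
has to be true, and an oracle query, which has to have a positive answer. -/
theorem inNP_of_exec {α : Type*} {code : α → List Bool} {L : Set α} {p : Polynomial ℕ}
    (bit : α → List Bool → Bool) (query : α → List Bool → List Bool)
    (hc : ∀ a (g : List Bool), g.length = (code a).length → ∃ n ≤ p.eval (code a).length, ∃ s',
      Exec (behaviour tm) c (regs [] ((code a).reverse.map some) (g.map some) []) n s' ∧
      (s' 0).head? = some (some (bit a g)) ∧ s' 1 = (query a g).reverse.map some ∧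
      (query a g).length ≤ p.eval (code a).length)
    (hL : ∀ a, a ∈ L ↔ ∃ g : List Bool, g.length = (code a).length ∧ bit a g = true ∧ query a g ∈ O) :
    InNP O code L := by
  -- The summands account for guessing, the command, the test of the bit, and the transfer of the
  -- query with the query itself.
  refine ⟨guessMachine tm c, Polynomial.X + 1 + (p + 1 + (p + 3)), fun a => ?_⟩
  have key : ∀ g : List Bool, g.length = (code a).length → Outcome (guessMachine tm c) O
      ⟨some (.inl (entry tm c)), memory tm none,
        idle tm (regs [] ((code a).reverse.map some ++ []) (g.map some ++ []) []) (ioStk [] [])⟩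
      (p.eval (code a).length + 1 + (p.eval (code a).length + 3)) (bit a g = true ∧ query a g ∈ O) := by
    intro g hg
    obtain ⟨n, hn, s', he, hb, hq, hl⟩ := hc a g hg
    obtain ⟨x, hx⟩ := he.dRun (m := guessProgram tm c false) (G := fun l => ∃ l', l = Sum.inl l')
      (io := ioStk [] []) Sum.inl (.inr 1) (fun l => rfl) (fun l => ⟨l, rfl⟩) none
    simp only [List.append_nil]
    have hG : ∀ l : Lab tm c ⊕ Fin 6, (∃ l', l = Sum.inl l') → l ≠ (guessMachine tm c).accept ∧
        l ≠ (guessMachine tm c).query ∧ (guessMachine tm c).m' l = (guessMachine tm c).tm.m l := by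
      rintro _ ⟨l, rfl⟩
      exact ⟨by simp [guessMachine], by simp [guessMachine], rfl⟩
    refine (Outcome.dRun (M := guessMachine tm c) (O := O) hG hx
      (b := 1 + (p.eval (code a).length + 3)) (P := bit a g = true ∧ query a g ∈ O) ?_).mono
      (by omega) Iff.rfl
    have h2 := outcome_ask (tm := tm) (c := c) (O := O) (query a g).reverse [] (some (some (bit a g)))
      (Function.update s' 0 (s' 0).tail) (by simpa using hq)
    have hstep : ∀ t, stepAux (guessProgram tm c t (.inr 1)) (memory tm x) (idle tm s' (ioStk [] [])) =
        ⟨if bit a g = true then some (.inr 2) else none, memory tm (some (some (bit a g))),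
          idle tm (Function.update s' 0 (s' 0).tail) (ioStk [] [])⟩ := fun t => by
      cases h : bit a g <;> simp [guessProgram, idle, memory, hb, h]
    have h3 : Outcome (guessMachine tm c) O
        ⟨if bit a g = true then some (.inr 2) else none, memory tm (some (some (bit a g))),
          idle tm (Function.update s' 0 (s' 0).tail) (ioStk [] [])⟩ ((query a g).length + 3)
        (bit a g = true ∧ query a g ∈ O) := by
      by_cases h : bit a g = true
      · simpa [h] using h2
      · rw [if_neg h]
        exact (Outcome.halted rfl _).mono le_rfl (by simp [h])
    refine (Outcome.branch_eq ?_ ?_ (hstep false) (hstep true) h3 h3).mono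
      (by omega) (by simp)
    · simp [guessMachine]
    · simp [guessMachine]
  have main := outcome_guess (code a) _ _ none [] [] key
  have hinit : (guessMachine tm c).init (code a) =
      ⟨some (.inr 0), memory tm none, idle tm (regs [] [] [] []) (ioStk (code a) [])⟩ := by
    have h := initList_stk (guessMachine tm c).tm ((code a).map (guessMachine tm c).inBit.symm)
    have h' : (initList (guessMachine tm c).tm ((code a).map (guessMachine tm c).inBit.symm)).stk =
        idle tm (regs [] [] [] []) (ioStk (code a) []) := by
      refine h.trans ?_
      change Function.update (fun _ => [] : ∀ k, List (Alphabet tm k)) (.inr (.inl false))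
        (List.map id (code a)) = _
      have : (fun _ => [] : ∀ k, List (Alphabet tm k)) = idle tm (regs [] [] [] []) (ioStk [] []) := by
        funext k
        rcases k with k | k | k
        · fin_cases k <;> rfl
        · cases k <;> rfl
        · rfl
      rw [this, List.map_id]
      simp [idle]
    change Cfg.mk _ _ _ = _
    rw [← h']
    rfl
  rw [← hinit] at main
  refine ⟨fun n c' hr => ?_, ?_⟩
  · have := main.1 n c' hr
    simpa using this
  · rw [hL]
    exact main.2

end Machine

end Compile

end Cplx

namespace Cplx

/-! ### Polynomial time functions -/

/-! ### Commands that operate on a stack of words -/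

section Words

variable {ι : Type} {R : Calls ι}

/-- `c` leads from `s` to `s'` in at most `n` steps. -/
def Runs (R : Calls ι) (c : Cmd ι) (s : Regs) (n : ℕ) (s' : Regs) : Prop :=
  ∃ m ≤ n, Exec R c s m s'

theorem Runs.mono {c : Cmd ι} {s s' : Regs} {n m : ℕ} (h : Runs R c s n s') (hn : n ≤ m) :
    Runs R c s m s' :=
  let ⟨k, hk, he⟩ := h
  ⟨k, hk.trans hn, he⟩

theorem Runs.cast {c : Cmd ι} {s s' s'' : Regs} {n : ℕ} (h : Runs R c s n s') (e : s' = s'') :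
    Runs R c s n s'' := e ▸ h

theorem Runs.skip (s : Regs) : Runs R .skip s 1 s := ⟨1, le_rfl, .skip s⟩

theorem Runs.push (k : Fin 4) (x : Sym) (s : Regs) :
    Runs R (.push k x) s 1 (Function.update s k (x :: s k)) := ⟨1, le_rfl, .push k x s⟩

theorem Runs.seq {c₁ c₂ : Cmd ι} {s s' s'' : Regs} {n m : ℕ} (h₁ : Runs R c₁ s n s')
    (h₂ : Runs R c₂ s' m s'') : Runs R (.seq c₁ c₂) s (n + m) s'' :=
  let ⟨_, hk, he⟩ := h₁
  let ⟨_, hk', he'⟩ := h₂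
  ⟨_, Nat.add_le_add hk hk', .seq he he'⟩

theorem Runs.last {k : Fin 4} {body : Option Sym → Cmd ι} {last : Option Sym → Bool} {s s' : Regs}
    {n : ℕ} (hs : last (s k).head? = true)
    (h : Runs R (body (s k).head?) (Function.update s k (s k).tail) n s') :
    Runs R (.loop k body last) s (n + 1) s' :=
  let ⟨_, hk, he⟩ := h
  ⟨_, Nat.add_le_add_right hk 1, .last hs he⟩

theorem Runs.next {k : Fin 4} {body : Option Sym → Cmd ι} {last : Option Sym → Bool}
    {s s' s'' : Regs} {n m : ℕ} (hs : last (s k).head? = false)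
    (h : Runs R (body (s k).head?) (Function.update s k (s k).tail) n s')
    (h' : Runs R (.loop k body last) s' m s'') :
    Runs R (.loop k body last) s (n + 1 + m) s'' :=
  let ⟨_, hk, he⟩ := h
  let ⟨_, hk', he'⟩ := h'
  ⟨_, by omega, .next hs he he'⟩

theorem Runs.push_zero (x : Sym) (d a b c : List Sym) :
    Runs R (.push 0 x) (regs d a b c) 1 (regs (x :: d) a b c) := by
  simpa using Runs.push (R := R) 0 x (regs d a b c)

/-- Pops the bits from stack `k` down to the next separator or the bottom, and executes `body` for
each of them. -/
def Cmd.each (k : Fin 4) (body : Bool → Cmd ι) : Cmd ι :=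
  .loop k (fun x => x.join.elim .skip body) (fun x => x.join.isNone)

/-- Moves a word from stack `k` to stack `j`. -/
def Cmd.move (k j : Fin 4) : Cmd ι := .each k fun b => .push j (some b)

theorem Runs.each_nil {k : Fin 4} {body : Bool → Cmd ι} {s : Regs} (hs : (s k).head?.join = none) :
    Runs R (.each k body) s 2 (Function.update s k (s k).tail) :=
  .last (n := 1) (by simp [hs]) (by simpa [hs] using Runs.skip _)

theorem Runs.each_cons {k : Fin 4} {body : Bool → Cmd ι} {s s' s'' : Regs} {b : Bool} {x : List Sym}
    {n m : ℕ} (hs : s k = some b :: x) (h : Runs R (body b) (Function.update s k x) n s')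
    (h' : Runs R (.each k body) s' m s'') : Runs R (.each k body) s (n + 1 + m) s'' :=
  .next (by simp [hs]) (by simpa [hs] using h) h'

/-- The condition on `x` covers both ways in which a word can end: by a separator, which is
consumed, or at the bottom of the stack. The word arrives reversed. -/
theorem Runs.move {k j : Fin 4} (hkj : k ≠ j) (w : List Bool) (x : List Sym)
    (hx : x.head?.join = none) (s : Regs) (hs : s k = w.map some ++ x) :
    Runs R (.move k j) s (2 * w.length + 2)
      (Function.update (Function.update s k x.tail) j (w.reverse.map some ++ s j)) := by
  induction w generalizing s with
  | nil =>
    have := Runs.each_nil (R := R) (k := k) (body := fun b => .push j (some b)) (s := s)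
      (by simpa [hs] using hx)
    simp only [List.map_nil, List.nil_append] at hs
    refine this.cast ?_
    funext i
    by_cases hi : i = j
    · subst hi; simp [hkj.symm]
    · simp [hi, hs]
  | cons b w ih =>
    have h₁ := Runs.push (R := R) j (some b) (Function.update s k (w.map some ++ x))
    have h₂ := ih (Function.update (Function.update s k (w.map some ++ x)) j
      (some b :: Function.update s k (w.map some ++ x) j)) (by simp [hkj])
    refine ((Runs.each_cons (x := w.map some ++ x) (by simpa using hs) h₁ h₂).mono
      (by simp; omega)).cast ?_
    funext i
    by_cases hi : i = j
    · subst hi; simp [hkj.symm]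
    · by_cases hk : i = k
      · subst hk; simp [hi]
      · simp [hi, hk]

variable (w : List Bool) (d a b c : List Sym)

theorem Runs.move_zero_one : Runs R (.move 0 1) (regs (w.map some ++ none :: d) a b c)
    (2 * w.length + 2) (regs d (w.reverse.map some ++ a) b c) := by
  simpa using Runs.move (R := R) (k := 0) (j := 1) (by decide) w (none :: d) rfl
    (regs (w.map some ++ none :: d) a b c) rfl

theorem Runs.move_zero_two : Runs R (.move 0 2) (regs (w.map some ++ none :: d) a b c)
    (2 * w.length + 2) (regs d a (w.reverse.map some ++ b) c) := by
  simpa using Runs.move (R := R) (k := 0) (j := 2) (by decide) w (none :: d) rfl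
    (regs (w.map some ++ none :: d) a b c) rfl

theorem Runs.move_one_zero : Runs R (.move 1 0) (regs d (w.map some) b c)
    (2 * w.length + 2) (regs (w.reverse.map some ++ d) [] b c) := by
  simpa using Runs.move (R := R) (k := 1) (j := 0) (by decide) w [] rfl
    (regs d (w.map some) b c) (by simp)

theorem Runs.move_two_zero : Runs R (.move 2 0) (regs d a (w.map some) c)
    (2 * w.length + 2) (regs (w.reverse.map some ++ d) a [] c) := by
  simpa using Runs.move (R := R) (k := 2) (j := 0) (by decide) w [] rfl
    (regs d a (w.map some) c) (by simp)

theorem Runs.move_two_one : Runs R (.move 2 1) (regs d a (w.map some) c)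
    (2 * w.length + 2) (regs d (w.reverse.map some ++ a) [] c) := by
  simpa using Runs.move (R := R) (k := 2) (j := 1) (by decide) w [] rfl
    (regs d a (w.map some) c) (by simp)

/-- A stack of words, each followed by a separator. -/
def enc (l : List (List Bool)) : List Sym := l.flatMap fun w => w.map some ++ [none]

@[simp] theorem enc_cons (l : List (List Bool)) : enc (w :: l) = w.map some ++ none :: enc l := by
  simp [enc]

/-- With a stack of words on stack `0` and the others empty, `c` replaces the words `l` on top of the
stack by `l'`, in at most `n` steps. -/
def Does (R : Calls ι) (c : Cmd ι) (n : ℕ) (l l' : List (List Bool)) : Prop :=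
  ∀ r, Runs R c (regs (enc (l ++ r)) [] [] []) n (regs (enc (l' ++ r)) [] [] [])

variable {w}

theorem Does.mono {c : Cmd ι} {n m : ℕ} {l l' : List (List Bool)} (h : Does R c n l l')
    (hn : n ≤ m) : Does R c m l l' := fun r => (h r).mono hn

theorem Does.seq {c₁ c₂ : Cmd ι} {n m : ℕ} {l l' l'' : List (List Bool)} (h₁ : Does R c₁ n l l')
    (h₂ : Does R c₂ m l' l'') : Does R (.seq c₁ c₂) (n + m) l l'' := fun r => (h₁ r).seq (h₂ r)

theorem Does.frame {c : Cmd ι} {n : ℕ} {l l' : List (List Bool)} (h : Does R c n l l')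
    (t : List (List Bool)) : Does R c n (l ++ t) (l' ++ t) := fun r => by
  simpa using h (t ++ r)

theorem Does.skip (l : List (List Bool)) : Does R .skip 1 l l := fun _ => .skip _

variable (w) (v : List Bool)

/-- Duplicates the top word. -/
def Cmd.dup : Cmd ι :=
  .seq (.move 0 1) (.seq (.push 0 none) (.seq
    (.each 1 fun b => .seq (.push 0 (some b)) (.push 2 (some b)))
    (.seq (.push 0 none) (.seq (.move 2 1) (.move 1 0)))))

/-- Popping the reversed word from stack `1` puts one copy on stack `0` and one on stack `2`. A
single move would reverse the latter, so it goes back by way of stack `1`. -/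
theorem Does.dup : Does R .dup (9 * w.length + 10) [w] [w, w] := by
  intro r
  have copy : ∀ (u : List Bool) (d b : List Sym), Runs R
      (.each 1 fun b => .seq (.push 0 (some b)) (.push 2 (some b))) (regs d (u.map some) b [])
      (3 * u.length + 2) (regs (u.reverse.map some ++ d) [] (u.reverse.map some ++ b) []) := by
    intro u
    induction u with
    | nil => exact fun d b => by simpa using Runs.each_nil (R := R) (k := 1) (s := regs d [] b []) rfl
    | cons x u ih =>
      intro d b
      have h := ih (some x :: d) (some x :: b)
      have h₁ := Runs.push (R := R) 0 (some x) (regs d (u.map some) b [])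
      have h₂ := Runs.push (R := R) 2 (some x) (regs (some x :: d) (u.map some) b [])
      simp only [update_regs_zero, update_regs_two, regs_zero, regs_two] at h₁ h₂
      have := Runs.each_cons (R := R) (k := 1) (body := fun b => .seq (.push 0 (some b)) (.push 2 (some b)))
        (s := regs d ((x :: u).map some) b []) (b := x) (x := u.map some) rfl
        (by simpa using h₁.seq h₂) h
      simpa using this.mono (by simp; omega)
  have h₁ := Runs.move_zero_one (R := R) w (enc r) [] [] []
  have h₂ := copy w.reverse (none :: enc r) []
  have h₃ := Runs.move_two_one (R := R) w (none :: (w.map some ++ none :: enc r)) [] []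
  have h₄ := Runs.move_one_zero (R := R) w.reverse (none :: (w.map some ++ none :: enc r)) [] []
  simp only [List.append_nil, List.reverse_reverse, List.length_reverse] at h₁ h₂ h₃ h₄
  simpa [Cmd.dup] using (h₁.seq ((Runs.push_zero none _ _ _ _).seq (h₂.seq ((Runs.push_zero none _ _ _ _).seq
    (h₃.seq h₄))))).mono (by omega)

/-- Exchanges the two top words. -/
def Cmd.swap : Cmd ι :=
  .seq (.move 0 1) (.seq (.move 0 2) (.seq (.push 0 none) (.seq (.move 1 0)
    (.seq (.push 0 none) (.move 2 0)))))

theorem Does.swap : Does R .swap (4 * w.length + 4 * v.length + 10) [w, v] [v, w] := by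
  intro r
  have h₁ := Runs.move_zero_one (R := R) w (v.map some ++ none :: enc r) [] [] []
  have h₂ := Runs.move_zero_two (R := R) v (enc r) (w.reverse.map some) [] []
  have h₃ := Runs.move_one_zero (R := R) w.reverse (none :: enc r) (v.reverse.map some) []
  have h₄ := Runs.move_two_zero (R := R) v.reverse (none :: (w.map some ++ none :: enc r)) [] []
  simp only [List.append_nil, List.reverse_reverse, List.length_reverse] at h₁ h₂ h₃ h₄
  simpa [Cmd.swap] using (h₁.seq (h₂.seq ((Runs.push_zero none _ _ _ _).seq (h₃.seq
    ((Runs.push_zero none _ _ _ _).seq h₄))))).mono (by omega)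

/-- Removes the top word. -/
def Cmd.drop : Cmd ι := .each 0 fun _ => .skip

theorem Runs.drop : Runs R .drop (regs (w.map some ++ none :: d) a b c) (2 * w.length + 2)
    (regs d a b c) := by
  induction w with
  | nil => simpa [Cmd.drop] using Runs.each_nil (R := R) (k := 0) (s := regs (none :: d) a b c) rfl
  | cons x w ih =>
    have := Runs.each_cons (R := R) (k := 0) (body := fun _ => .skip)
      (s := regs ((x :: w).map some ++ none :: d) a b c) (b := x) (x := w.map some ++ none :: d) rfl
      (by simpa using Runs.skip _) ih
    exact this.mono (by simp; omega)

theorem Does.drop : Does R .drop (2 * w.length + 2) [w] [] := fun r => by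
  simpa using Runs.drop w (enc r) [] [] []

/-- Pushes the word `w`. -/
def Cmd.const : List Bool → Cmd ι
  | [] => .push 0 none
  | b :: w => .seq (.const w) (.push 0 (some b))

theorem Does.const : Does R (.const w) (w.length + 1) [] [w] := by
  intro r
  induction w with
  | nil => simpa [Cmd.const] using Runs.push_zero (R := R) none (enc r) [] [] []
  | cons x w ih => simpa [Cmd.const] using ih.seq (Runs.push_zero (some x) _ _ _ _)

/-- Concatenates the two top words. -/
def Cmd.append : Cmd ι := .seq (.move 0 1) (.move 1 0)

theorem Does.append : Does R .append (4 * w.length + 4) [w, v] [w ++ v] := by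
  intro r
  have h₁ := Runs.move_zero_one (R := R) w (v.map some ++ none :: enc r) [] [] []
  have h₂ := Runs.move_one_zero (R := R) w.reverse (v.map some ++ none :: enc r) [] []
  simp only [List.append_nil, List.reverse_reverse, List.length_reverse] at h₁ h₂
  simpa [Cmd.append] using (h₁.seq h₂).mono (by omega)

@[simp] theorem block_nil : block [] = [false] := rfl

@[simp] theorem block_cons (x : Bool) : block (x :: w) = true :: x :: block w := rfl

@[simp] theorem length_block : (block w).length = 2 * w.length + 1 := by
  induction w with
  | nil => rfl
  | cons x w ih => simp [ih]; omega

/-- Replaces the top word `w` by `block w`. -/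
def Cmd.block : Cmd ι :=
  .seq (.move 0 1) (.seq (.push 0 none) (.seq (.push 0 (some false))
    (.each 1 fun b => .seq (.push 0 (some b)) (.push 0 (some true)))))

theorem Does.block : Does R .block (5 * w.length + 6) [w] [Cplx.block w] := by
  intro r
  -- The code is built from the last bit to the first: pushing `x` and then `true` turns `block v`
  -- into `block (x :: v)`.
  have key : ∀ (u v : List Bool), Runs R
      (.each 1 fun b => .seq (.push 0 (some b)) (.push 0 (some true)))
      (regs ((Cplx.block v).map some ++ none :: enc r) (u.map some) [] [])
      (3 * u.length + 2) (regs ((Cplx.block (u.reverse ++ v)).map some ++ none :: enc r) [] [] []) := by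
    intro u
    induction u with
    | nil =>
      intro v
      simpa using Runs.each_nil (R := R) (k := 1)
        (s := regs ((Cplx.block v).map some ++ none :: enc r) [] [] []) rfl
    | cons x u ih =>
      intro v
      have h := ih (x :: v)
      have h₁ := Runs.push_zero (R := R) (some x) ((Cplx.block v).map some ++ none :: enc r)
        (u.map some) [] []
      have h₂ := Runs.push_zero (R := R) (some true) (some x :: ((Cplx.block v).map some ++ none :: enc r))
        (u.map some) [] []
      have := Runs.each_cons (R := R) (k := 1)
        (body := fun b => .seq (.push 0 (some b)) (.push 0 (some true)))
        (s := regs ((Cplx.block v).map some ++ none :: enc r) ((x :: u).map some) [] [])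
        (b := x) (x := u.map some) rfl (by simpa using h₁.seq h₂) h
      simpa using this.mono (by simp; omega)
  have h₁ := Runs.move_zero_one (R := R) w (enc r) [] [] []
  have h₂ := key w.reverse []
  simp only [List.append_nil, List.reverse_reverse, List.length_reverse] at h₁ h₂
  simpa [Cmd.block] using (h₁.seq ((Runs.push_zero none _ _ _ _).seq ((Runs.push_zero (some false) _ _ _ _).seq
    h₂))).mono (by omega)

/-- Pops one symbol from stack `k` and executes `body`. -/
def Cmd.case (k : Fin 4) (body : Option Sym → Cmd ι) : Cmd ι := .loop k body fun _ => true

/-- Splits the first block from the top word. -/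
def Cmd.split : Cmd ι :=
  .seq (.loop 0 (fun x => if x = some (some true) then .case 0 fun y => .push 1 (y.getD none) else .skip)
    (fun x => decide (x ≠ some (some true)))) (.seq (.push 0 none) (.move 1 0))

theorem Does.split : Does R .split (5 * w.length + 5) [Cplx.block w ++ v] [w, v] := by
  intro r
  have key : ∀ (w : List Bool) (x : List Sym), Runs R
      (.loop 0 (fun x => if x = some (some true) then .case 0 fun y => .push 1 (y.getD none) else .skip)
        (fun x => decide (x ≠ some (some true))))
      (regs ((Cplx.block w).map some ++ (v.map some ++ none :: enc r)) x [] [])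
      (3 * w.length + 2) (regs (v.map some ++ none :: enc r) (w.reverse.map some ++ x) [] []) := by
    intro w
    induction w with
    | nil => exact fun x => .last (n := 1) (by simp) (by simpa using Runs.skip _)
    | cons y w ih =>
      intro x
      have h := ih (some y :: x)
      have h₁ := Runs.push (R := R) 1 (some y)
        (regs ((Cplx.block w).map some ++ (v.map some ++ none :: enc r)) x [] [])
      have h₂ : Runs R (.case 0 fun y => .push 1 (y.getD none))
        (regs (some y :: ((Cplx.block w).map some ++ (v.map some ++ none :: enc r))) x [] []) 2
        (regs ((Cplx.block w).map some ++ (v.map some ++ none :: enc r)) (some y :: x) [] []) :=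
        .last (n := 1) rfl (by simpa using h₁)
      refine ((Runs.next (by simp) (by simpa using h₂) h).mono (by simp; omega)).cast ?_
      simp
  have h₁ := key w []
  have h₂ := Runs.move_one_zero (R := R) w.reverse (none :: (v.map some ++ none :: enc r)) [] []
  simp only [List.append_nil, List.reverse_reverse, List.length_reverse] at h₁ h₂
  have := h₁.seq ((Runs.push_zero none _ _ _ _).seq h₂)
  simpa [Cmd.split] using this.mono (m := 5 * w.length + 5) (by omega)

/-- Replaces the top word by the result of a test of its first bit. -/
def Cmd.test (φ : Option Bool → Bool) : Cmd ι :=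
  .case 0 fun x => x.join.elim (.const [φ none]) fun b => .seq .drop (.const [φ (some b)])

theorem Does.test (φ : Option Bool → Bool) : Does R (.test φ) (2 * w.length + 5) [w] [[φ w.head?]] := by
  intro r
  cases w with
  | nil =>
    refine Runs.last (n := 2) rfl ?_ |>.mono (by simp)
    simpa using Does.const (R := R) [φ none] r
  | cons x w =>
    refine (Runs.last (n := 2 * w.length + 2 + 2) rfl ?_).mono (by simp)
    simpa using (Does.drop (R := R) w r).seq (Does.const (R := R) [φ (some x)] r)

/-- Removes the first bit of the top word. -/
def Cmd.tail : Cmd ι := .case 0 fun x => if x = some none then .push 0 none else .skip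

theorem Does.tail : Does R .tail 2 [w] [w.tail] := by
  intro r
  cases w with
  | nil =>
    refine Runs.last (n := 1) rfl ?_
    simpa using Runs.push_zero (R := R) none (enc r) [] [] []
  | cons x w =>
    refine Runs.last (n := 1) rfl ?_
    simpa using Runs.skip _

/-- Removes the top bit and executes one of two commands. -/
def Cmd.branch (c₁ c₂ : Cmd ι) : Cmd ι :=
  .case 0 fun x => .seq .drop (if x = some (some true) then c₁ else c₂)

theorem Does.branch {c₁ c₂ : Cmd ι} {n : ℕ} {l l' : List (List Bool)} (x : Bool)
    (h : Does R (cond x c₁ c₂) n l l') : Does R (.branch c₁ c₂) (n + 3) ([x] :: l) l' := by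
  intro r
  refine (Runs.last (n := 2 + n) rfl ?_).mono (by omega)
  have := (Does.drop (R := R) [] (l ++ r)).seq (h r)
  cases x <;> simpa using this

/-- Removes the top bit, and as long as it is true executes `c`. -/
def Cmd.while (c : Cmd ι) : Cmd ι :=
  .loop 0 (fun x => .seq .drop (if x = some (some true) then c else .skip))
    (fun x => decide (x ≠ some (some true)))

theorem Does.while_false (c : Cmd ι) (l : List (List Bool)) : Does R (.while c) 4 ([false] :: l) l := by
  intro r
  refine Runs.last (n := 2 + 1) rfl ?_
  simpa using (Does.drop (R := R) [] (l ++ r)).seq (Runs.skip _)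

theorem Does.while_true {c : Cmd ι} {n m : ℕ} {l l' l'' : List (List Bool)} (h : Does R c n l l')
    (h' : Does R (.while c) m l' l'') : Does R (.while c) (n + 3 + m) ([true] :: l) l'' := by
  intro r
  refine (Runs.next (n := 2 + n) rfl ?_ (h' r)).mono (by omega)
  simpa using (Does.drop (R := R) [] (l ++ r)).seq (h r)

/-- Replaces the two top words by a bit that tells whether they are equal. -/
def Cmd.eq : Cmd ι :=
  .seq (.move 0 1) (.seq (.move 0 2) (.seq
    (.each 1 fun x => .case 2 fun y => if y = some (some x) then .skip else .push 3 (some true))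
    (.seq (.each 2 fun _ => .push 3 (some true))
      (.case 3 fun x => if x = none then .const [true] else
        .seq (.each 3 fun _ => .skip) (.const [false])))))

/-- The reversed words are compared symbol by symbol. Stack `3` receives a mark for each mismatch
and for each symbol left over, so equality means that it stays empty. -/
theorem Does.eq : Does R .eq (7 * w.length + 6 * v.length + 13) [w, v] [[decide (w = v)]] := by
  intro r
  -- Here `k` counts the marks made before. If `v` is too short, the pop returns `none`, which
  -- counts as a mismatch; if it is too long, the rest `v.drop u.length` is marked by `flush`.
  have cmp : ∀ (u v : List Bool) (k : ℕ), ∃ k' : ℕ, k' ≤ k + u.length ∧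
      (k' = 0 ∧ v.drop u.length = [] ↔ k = 0 ∧ u = v) ∧ Runs R
      (.each 1 fun x => .case 2 fun y => if y = some (some x) then .skip else .push 3 (some true))
      (regs (enc r) (u.map some) (v.map some) (List.replicate k (some true))) (3 * u.length + 2)
      (regs (enc r) [] ((v.drop u.length).map some) (List.replicate k' (some true))) := by
    intro u
    induction u with
    | nil =>
      intro v k
      refine ⟨k, le_rfl, by simp [eq_comm], ?_⟩
      simpa using Runs.each_nil (R := R) (k := 1)
        (s := regs (enc r) [] (v.map some) (List.replicate k (some true))) rfl
    | cons x u ih =>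
      intro v k
      by_cases hx : v.head? = some x
      · obtain ⟨v, rfl⟩ : ∃ v', v = x :: v' := by
          cases v with
          | nil => simp at hx
          | cons y v => exact ⟨v, by simpa using hx⟩
        obtain ⟨k', h₁, h₂, h₃⟩ := ih v k
        refine ⟨k', by simp; omega, by simpa using h₂, ?_⟩
        refine (Runs.each_cons (n := 2) (b := x) (x := u.map some) (by simp) ?_ h₃).mono (by simp; omega)
        exact Runs.last (n := 1) rfl (by simpa using Runs.skip _)
      · obtain ⟨k', h₁, h₂, h₃⟩ := ih v.tail (k + 1)
        refine ⟨k', by simp; omega, ?_, ?_⟩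
        · have : v.drop (u.length + 1) = v.tail.drop u.length := by simp
          rw [List.length_cons, this, h₂]
          constructor
          · rintro ⟨h, -⟩
            omega
          · rintro ⟨-, rfl⟩
            simp at hx
        · refine (Runs.each_cons (n := 2) (b := x) (x := u.map some)
            (s' := regs (enc r) (u.map some) (v.tail.map some) (List.replicate (k + 1) (some true)))
            (by simp) ?_ (h₃.cast (by simp))).mono (by simp; omega)
          refine Runs.last (n := 1) rfl ?_
          have : (v.map some).head? ≠ some (some x) := by simpa using hx
          simpa [hx, List.replicate_succ] using Runs.push (R := R) 3 (some true)
            (regs (enc r) (u.map some) (v.map some).tail (List.replicate k (some true)))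
  have flush : ∀ (v : List Bool) (k : ℕ), Runs R (.each 2 fun _ => .push 3 (some true))
      (regs (enc r) [] (v.map some) (List.replicate k (some true))) (2 * v.length + 2)
      (regs (enc r) [] [] (List.replicate (k + v.length) (some true))) := by
    intro v
    induction v with
    | nil =>
      intro k
      simpa using Runs.each_nil (R := R) (k := 2)
        (s := regs (enc r) [] [] (List.replicate k (some true))) rfl
    | cons x v ih =>
      intro k
      refine ((Runs.each_cons (n := 1) (b := x) (x := v.map some) (by simp) ?_ (ih (k + 1))).mono
        (by simp; omega)).cast (by rw [List.length_cons, Nat.add_right_comm, Nat.add_assoc])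
      simpa [List.replicate_succ] using Runs.push (R := R) 3 (some true)
            (regs (enc r) [] (v.map some) (List.replicate k (some true)))
  have clear : ∀ k : ℕ, Runs R (.each 3 fun _ => .skip)
      (regs (enc r) [] [] (List.replicate k (some true))) (2 * k + 2) (regs (enc r) [] [] []) := by
    intro k
    induction k with
    | zero => simpa using Runs.each_nil (R := R) (k := 3) (s := regs (enc r) [] [] []) rfl
    | succ k ih =>
      exact (Runs.each_cons (n := 1) (x := List.replicate k (some true)) (b := true)
        (by simp [List.replicate_succ]) (by simpa using Runs.skip _) ih).mono (by omega)
  obtain ⟨k, hk, hk', h₃⟩ := cmp w.reverse v.reverse 0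
  have h₁ := Runs.move_zero_one (R := R) w (v.map some ++ none :: enc r) [] [] []
  have h₂ := Runs.move_zero_two (R := R) v (enc r) (w.reverse.map some) [] []
  have h₄ := flush (v.reverse.drop w.reverse.length) k
  have h₅ : Runs R (.case 3 fun x => if x = none then .const [true] else
        .seq (.each 3 fun _ => .skip) (.const [false]))
      (regs (enc r) [] [] (List.replicate (k + (v.reverse.drop w.reverse.length).length) (some true)))
      (2 * (k + (v.reverse.drop w.reverse.length).length) + 5)
      (regs (enc ([decide (w = v)] :: r)) [] [] []) := by
    by_cases hwv : w = v
    · obtain ⟨rfl, h⟩ := hk'.2 (by simp [hwv])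
      rw [h]
      refine (Runs.last (n := 2) rfl ?_).mono (by omega)
      simpa [hwv] using Does.const (R := R) [true] r
    · have : k + (v.reverse.drop w.reverse.length).length ≠ 0 := fun h => hwv (by
        have := (hk'.1 ⟨by omega, List.length_eq_zero_iff.1 (by omega)⟩).2
        simpa using this)
      obtain ⟨j, hj⟩ := Nat.exists_eq_succ_of_ne_zero this
      rw [hj]
      refine (Runs.last (n := 2 * j + 2 + 2) rfl ?_).mono (by omega)
      simpa [hwv, List.replicate_succ] using (clear j).seq (Does.const (R := R) [false] r)
  simp only [List.append_nil, List.length_reverse, List.length_drop] at h₁ h₂ h₃ h₄ h₅ hk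
  have := h₁.seq (h₂.seq (h₃.seq (h₄.seq h₅)))
  simpa [Cmd.eq] using this.mono (m := 7 * w.length + 6 * v.length + 13) (by omega)

end Words

end Cplx

namespace Cplx

/-! ### Closure properties of polynomial time functions -/

section Functions

variable {ι : Type} {R : Calls ι}

theorem monotone_eval (p : Polynomial ℕ) : Monotone fun n => p.eval n := fun a b h => by
  simp only [Polynomial.eval_eq_sum, Polynomial.sum]
  gcongr

/-- The function `f` on codes is computed by a command in polynomial time. -/
def Poly (R : Calls ι) {α β : Type*} (ca : α → List Bool) (cb : β → List Bool) (f : α → β) : Prop :=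
  ∃ (c : Cmd ι) (p : Polynomial ℕ), ∀ a, Does R c (p.eval (ca a).length) [ca a] [cb (f a)] ∧
    (cb (f a)).length ≤ p.eval (ca a).length

variable {α β γ δ : Type*} {ca : α → List Bool} {cb : β → List Bool} {cc : γ → List Bool}
  {cd : δ → List Bool}

theorem Poly.congr {f : α → β} {g : α → γ} (h : Poly R ca cb f) (e : ∀ a, cb (f a) = cc (g a)) :
    Poly R ca cc g := by
  obtain ⟨c, p, h⟩ := h
  exact ⟨c, p, fun a => e a ▸ h a⟩

theorem Poly.reindex {f : α → β} (h : Poly R ca cb f) (i : γ → α) (e : ∀ x, cc x = ca (i x)) :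
    Poly R cc cb fun x => f (i x) := by
  obtain ⟨c, p, h⟩ := h
  exact ⟨c, p, fun x => e x ▸ h (i x)⟩

variable (ca) in
theorem Poly.id : Poly R ca ca fun a => a :=
  ⟨.skip, Polynomial.X + 1, fun a => ⟨(Does.skip _).mono (by simp), by simp⟩⟩

/-- The bound on the output of `f` limits the input of the second command, and polynomials with
natural coefficients are monotone. -/
theorem Poly.comp {g : β → γ} {f : α → β} (hg : Poly R cb cc g) (hf : Poly R ca cb f) :
    Poly R ca cc fun a => g (f a) := by
  obtain ⟨c, p, h⟩ := hf
  obtain ⟨c', p', h'⟩ := hg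
  refine ⟨.seq c c', p + p'.comp p, fun a => ⟨((h a).1.seq (h' _).1).mono ?_, (h' _).2.trans ?_⟩⟩
  · simpa using monotone_eval p' (h a).2
  · simpa using (monotone_eval p' (h a).2).trans (Nat.le_add_left _ _)

variable (ca cb) in
theorem Poly.const (b : β) : Poly R ca cb fun _ => b := by
  refine ⟨.seq .drop (.const (cb b)), 2 * Polynomial.X + Polynomial.C ((cb b).length + 3), fun a => ⟨?_, ?_⟩⟩
  · exact ((Does.drop _).seq (Does.const _)).mono (by simp; omega)
  · simp; omega

/-- Application of a binary operation to two results. -/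
theorem Poly.binary {f : α → β} {g : α → γ} {h : α → δ} (hf : Poly R ca cb f) (hg : Poly R ca cc g)
    (op : Cmd ι) (k : ℕ)
    (hop : ∀ a, Does R op (k * ((cb (f a)).length + (cc (g a)).length + 1))
      [cb (f a), cc (g a)] [cd (h a)])
    (hlen : ∀ a, (cd (h a)).length ≤ (cb (f a)).length + (cc (g a)).length + 1) :
    Poly R ca cd h := by
  obtain ⟨c, p, hc⟩ := hf
  obtain ⟨c', p', hc'⟩ := hg
  refine ⟨.seq .dup (.seq c' (.seq .swap (.seq c op))),
    20 + 20 * Polynomial.X + 20 * p + 20 * p' + Polynomial.C k * (p + p' + 1), fun a => ⟨?_, ?_⟩⟩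
  · have h₁ := Does.dup (R := R) (ca a)
    have h₂ := (hc' a).1.frame [ca a]
    have h₃ := Does.swap (R := R) (cc (g a)) (ca a)
    have h₄ := (hc a).1.frame [cc (g a)]
    refine (h₁.seq (h₂.seq (h₃.seq (h₄.seq (hop a))))).mono ?_
    have h₅ := (hc a).2
    have h₆ := (hc' a).2
    have h₇ : k * ((cb (f a)).length + (cc (g a)).length + 1) ≤
        k * (p.eval (ca a).length + p'.eval (ca a).length + 1) := by gcongr
    simp at h₇ ⊢
    omega
  · have := (hc a).2
    have := (hc' a).2
    have := hlen a
    simp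
    omega

/-- Concatenation of two results. -/
theorem Poly.append {f : α → β} {g : α → γ} {h : α → δ} (hf : Poly R ca cb f) (hg : Poly R ca cc g)
    (e : ∀ a, cd (h a) = cb (f a) ++ cc (g a)) : Poly R ca cd h :=
  .binary hf hg .append 4 (fun a => e a ▸ (Does.append _ _).mono (by omega)) fun a => by
    rw [e]; simp

theorem Poly.block {f : α → β} {h : α → δ} (hf : Poly R ca cb f)
    (e : ∀ a, cd (h a) = Cplx.block (cb (f a))) : Poly R ca cd h := by
  have : Poly R (fun w => w) (fun w => w) Cplx.block :=
    ⟨.block, 6 + 5 * Polynomial.X, fun w => ⟨(Does.block w).mono (by simp; omega), by simp; omega⟩⟩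
  exact Poly.congr (this.comp (hf.congr (cc := fun w => w) (g := fun a => cb (f a)) fun _ => rfl))
    fun a => (e a).symm

/-- The first block of a word. -/
theorem Poly.first {f : α → β} {g : α → List Bool} (e : ∀ a, ca a = Cplx.block (cb (f a)) ++ g a) :
    Poly R ca cb f := by
  refine ⟨.seq .split (.seq .swap .drop), 30 + 30 * Polynomial.X, fun a => ⟨?_, ?_⟩⟩
  · have h₁ := Does.split (R := R) (cb (f a)) (g a)
    have h₂ := Does.swap (R := R) (cb (f a)) (g a)
    have h₃ := (Does.drop (R := R) (g a)).frame [cb (f a)]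
    rw [e]
    exact (h₁.seq (h₂.seq h₃)).mono (by simp; omega)
  · rw [e]; simp; omega

/-- What follows after the first block of a word. -/
theorem Poly.rest {f : α → β} {g : α → List Bool} (e : ∀ a, ca a = Cplx.block (g a) ++ cb (f a)) :
    Poly R ca cb f := by
  refine ⟨.seq .split .drop, 30 + 30 * Polynomial.X, fun a => ⟨?_, ?_⟩⟩
  · have h₁ := Does.split (R := R) (g a) (cb (f a))
    have h₃ := (Does.drop (R := R) (g a)).frame [cb (f a)]
    rw [e]
    exact (h₁.seq h₃).mono (by simp; omega)
  · rw [e]; simp; omega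

/-- Code of a truth value. -/
abbrev codeBool (b : Bool) : List Bool := [b]

theorem Poly.test {t : α → Bool} (φ : Option Bool → Bool) (e : ∀ a, t a = φ (ca a).head?) :
    Poly R ca codeBool t :=
  ⟨.test φ, 5 + 2 * Polynomial.X, fun a => ⟨e a ▸ (Does.test (ca a) φ).mono (by simp; omega), by simp; omega⟩⟩

theorem Poly.tail {f : α → β} (e : ∀ a, (ca a).tail = cb (f a)) : Poly R ca cb f :=
  ⟨.tail, 2 + Polynomial.X, fun a => ⟨e a ▸ (Does.tail (ca a)).mono (by simp),
    by rw [← e]; simp; omega⟩⟩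

/-- Definition by cases. -/
theorem Poly.cases {t : α → Bool} {f : α → β} (ht : Poly R ca codeBool t)
    (h₁ : Poly R (fun a : {a // t a = true} => ca a) cb fun a => f a)
    (h₂ : Poly R (fun a : {a // t a = false} => ca a) cb fun a => f a) : Poly R ca cb f := by
  obtain ⟨c, p, h⟩ := ht
  obtain ⟨c₁, p₁, h₁⟩ := h₁
  obtain ⟨c₂, p₂, h₂⟩ := h₂
  refine ⟨.seq .dup (.seq c (.branch c₁ c₂)), 20 + 20 * Polynomial.X + p + p₁ + p₂, fun a => ?_⟩
  have h₃ := Does.dup (R := R) (ca a)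
  have h₄ := (h a).1.frame [ca a]
  have h₅ : Does R (cond (t a) c₁ c₂) (p₁.eval (ca a).length + p₂.eval (ca a).length) [ca a] [cb (f a)] ∧
      (cb (f a)).length ≤ p₁.eval (ca a).length + p₂.eval (ca a).length := by
    cases hta : t a
    · exact ⟨(h₂ ⟨a, hta⟩).1.mono (by simp), (h₂ ⟨a, hta⟩).2.trans (by simp)⟩
    · exact ⟨(h₁ ⟨a, hta⟩).1.mono (by simp), (h₁ ⟨a, hta⟩).2.trans (by simp)⟩
  exact ⟨(h₃.seq (h₄.seq (h₅.1.branch (t a)))).mono (by simp; omega), h₅.2.trans (by simp only [Polynomial.eval_add]; omega)⟩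

theorem Poly.ite {t : α → Bool} {f g : α → β} (ht : Poly R ca codeBool t) (hf : Poly R ca cb f)
    (hg : Poly R ca cb g) : Poly R ca cb fun a => if t a then f a else g a := by
  refine .cases ht ?_ ?_
  · exact (hf.reindex Subtype.val fun _ => rfl).congr fun a => by simp [a.2]
  · exact (hg.reindex Subtype.val fun _ => rfl).congr fun a => by simp [a.2]

theorem Poly.not {s : α → Bool} (hs : Poly R ca codeBool s) : Poly R ca codeBool fun a => !s a :=
  (Poly.ite hs (.const ca codeBool false) (.const ca codeBool true)).congr fun a => by
    cases s a <;> rfl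

theorem Poly.and {s t : α → Bool} (hs : Poly R ca codeBool s) (ht : Poly R ca codeBool t) :
    Poly R ca codeBool fun a => s a && t a :=
  (Poly.ite hs ht (.const ca codeBool false)).congr fun a => by cases s a <;> simp

theorem Poly.or {s t : α → Bool} (hs : Poly R ca codeBool s) (ht : Poly R ca codeBool t) :
    Poly R ca codeBool fun a => s a || t a :=
  (Poly.ite hs (.const ca codeBool true) ht).congr fun a => by cases s a <;> simp

/-- Iteration of a polynomial time function as long as a test succeeds. -/
theorem Poly.iterate {t : γ → Bool} {F : γ → γ} (ht : Poly R cc codeBool t)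
    (hF : Poly R (fun x : {x // t x = true} => cc x) cc fun x => F x) (i : α → γ) (N : α → ℕ)
    (q : Polynomial ℕ) (h₁ : ∀ a, ∀ k < N a, t (F^[k] (i a)) = true)
    (h₂ : ∀ a, t (F^[N a] (i a)) = false) (h₃ : ∀ a, N a ≤ q.eval (cc (i a)).length)
    (h₄ : ∀ a, ∀ k ≤ N a, (cc (F^[k] (i a))).length ≤ q.eval (cc (i a)).length) :
    Poly R (fun a => cc (i a)) cc fun a => F^[N a] (i a) := by
  obtain ⟨c, p, ht⟩ := ht
  obtain ⟨c', p', hF⟩ := hF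
  -- A common bound `B` on the sizes of all iterates gives every round the same cost. It has to be
  -- assumed, since sizes may explode when a polynomial bound is iterated.
  have key : ∀ (B n : ℕ) (x : γ), (∀ k < n, t (F^[k] x) = true) → t (F^[n] x) = false →
      (∀ k ≤ n, (cc (F^[k] x)).length ≤ B) →
      Does R (.while (.seq c' (.seq .dup c))) (n * (p'.eval B + (9 * B + 10 + p.eval B) + 3) + 4)
        [[t x], cc x] [cc (F^[n] x)] := by
    intro B n
    induction n with
    | zero =>
      intro x _ hx _
      have hx : t x = false := hx
      rw [hx]
      exact (Does.while_false _ _).mono (by simp)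
    | succ n ih =>
      intro x hx hx' hB
      have hx0 : t x = true := hx 0 (by omega)
      have hB0 : (cc x).length ≤ B := hB 0 (by omega)
      have hB1 : (cc (F x)).length ≤ B := hB 1 (by omega)
      have := ih (F x) (fun k hk => hx (k + 1) (by omega)) hx' fun k hk => hB (k + 1) (by omega)
      rw [hx0]
      have d₁ := (hF ⟨x, hx0⟩).1
      have d₂ := Does.dup (R := R) (cc (F x))
      have d₃ := (ht (F x)).1.frame [cc (F x)]
      refine (Does.while_true (d₁.seq (d₂.seq d₃)) this).mono ?_
      have e₁ := monotone_eval p' hB0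
      have e₂ := monotone_eval p hB1
      dsimp only at e₁ e₂ ⊢
      rw [add_mul]
      omega
  refine ⟨.seq .dup (.seq c (.while (.seq c' (.seq .dup c)))),
    9 * q + 10 + p.comp q + (q * (p'.comp q + (9 * q + 10 + p.comp q) + 3) + 4), fun a => ?_⟩
  have hB0 : (cc (i a)).length ≤ q.eval (cc (i a)).length := h₄ a 0 (by omega)
  have d₁ := Does.dup (R := R) (cc (i a))
  have d₂ := (ht (i a)).1.frame [cc (i a)]
  refine ⟨(d₁.seq (d₂.seq (key _ _ _ (h₁ a) (h₂ a) (h₄ a)))).mono ?_, (h₄ a _ le_rfl).trans ?_⟩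
  · have e₂ := monotone_eval p hB0
    have e₃ := Nat.mul_le_mul_right (p'.eval (q.eval (cc (i a)).length) +
      (9 * q.eval (cc (i a)).length + 10 + p.eval (q.eval (cc (i a)).length)) + 3) (h₃ a)
    simp at e₂ ⊢
    omega
  · simp
    omega

/-- Code of a pair. -/
def pairCode (ca : α → List Bool) (cb : β → List Bool) (x : α × β) : List Bool :=
  Cplx.block (ca x.1) ++ Cplx.block (cb x.2)

theorem Poly.pair {f : α → β} {g : α → γ} (hf : Poly R ca cb f) (hg : Poly R ca cc g) :
    Poly R ca (pairCode cb cc) fun a => (f a, g a) :=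
  (hf.block (cd := fun w => w) fun _ => rfl).append (hg.block (cd := fun w => w) fun _ => rfl)
    fun _ => rfl

theorem Poly.fst : Poly R (pairCode ca cb) ca Prod.fst := .first fun _ => rfl

theorem Poly.snd : Poly R (pairCode ca cb) cb Prod.snd :=
  (Poly.first (ca := fun x : α × β => Cplx.block (cb x.2)) (g := fun _ => []) fun _ => by simp).comp
    (.rest (f := fun x => x) fun _ => rfl)

@[simp] theorem codeList_nil : codeList ca [] = [] := rfl

@[simp] theorem codeList_cons (a : α) (l : List α) :
    codeList ca (a :: l) = Cplx.block (ca a) ++ codeList ca l := rfl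

@[simp] theorem codeList_append (l l' : List α) :
    codeList ca (l ++ l') = codeList ca l ++ codeList ca l' := by simp [codeList]

theorem length_le_length_codeList (l : List α) : l.length ≤ (codeList ca l).length := by
  induction l with
  | nil => simp
  | cons a l ih => simp; omega

theorem length_le_of_mem_codeList {l : List α} {a : α} (h : a ∈ l) :
    (ca a).length ≤ (codeList ca l).length := by
  induction l with
  | nil => simp at h
  | cons b l ih =>
    rcases List.mem_cons.1 h with rfl | h
    · simp; omega
    · have := ih h
      simp; omega

theorem Poly.listAppend {f g : α → List β} (hf : Poly R ca (codeList cb) f)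
    (hg : Poly R ca (codeList cb) g) : Poly R ca (codeList cb) fun a => f a ++ g a :=
  hf.append hg fun _ => by simp

theorem Poly.singleton {f : α → β} (hf : Poly R ca cb f) : Poly R ca (codeList cb) fun a => [f a] :=
  hf.block fun _ => by simp

/-- Left folds whose intermediate results have polynomial size. -/
theorem Poly.foldl {l : α → List β} {s : α → γ} {step : α → γ → β → γ} (hl : Poly R ca (codeList cb) l)
    (hs : Poly R ca cc s)
    (hstep : Poly R (pairCode (pairCode ca cc) cb) cc fun x => step x.1.1 x.1.2 x.2)
    (q : Polynomial ℕ)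
    (hq : ∀ a l', l' <+: l a → (cc (l'.foldl (step a) (s a))).length ≤ q.eval (ca a).length) :
    Poly R ca cc fun a => (l a).foldl (step a) (s a) := by
  -- The state of the iteration: the argument, the accumulator and the members still to be
  -- processed.
  let cγ : (α × γ) × List β → List Bool := pairCode (pairCode ca cc) (codeList cb)
  let t : (α × γ) × List β → Bool := fun x => !x.2.isEmpty
  let F : (α × γ) × List β → (α × γ) × List β := fun x =>
    match x with
    | (x, []) => (x, [])
    | ((a, s), b :: l) => ((a, step a s b), l)
  let i : α → (α × γ) × List β := fun a => ((a, s a), l a)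
  have iter : ∀ (l' l : List β) (a : α) (s : γ),
      F^[l'.length] ((a, s), l' ++ l) = ((a, l'.foldl (step a) s), l) := by
    intro l'
    induction l' with
    | nil => simp
    | cons b l' ih => exact fun l a s => ih l a (step a s b)
  have iter' : ∀ (k : ℕ) (a : α), k ≤ (l a).length →
      F^[k] (i a) = ((a, ((l a).take k).foldl (step a) (s a)), (l a).drop k) := by
    intro k a hk
    have := iter ((l a).take k) ((l a).drop k) a (s a)
    rwa [List.take_append_drop, List.length_take, min_eq_left hk] at this
  have ht : Poly R cγ codeBool t := Poly.comp (g := fun l : List β => !l.isEmpty)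
    (Poly.test Option.isSome fun l => by
      cases l with
      | nil => rfl
      | cons b l => cases h : cb b <;> simp [h]) Poly.snd
  have hF : Poly R (fun x : {x // t x = true} => cγ x) cγ fun x => F x := by
    -- A nonempty list has the same code as the pair of its head and tail, so both can be split off.
    let cons : β × List β → List Bool := fun x => Cplx.block (cb x.1) ++ codeList cb x.2
    have h₁ : Poly R (pairCode (pairCode ca cc) cons) cb fun x => x.2.1 :=
      Poly.comp (g := Prod.fst) (.first fun _ => rfl) .snd
    have h₂ : Poly R (pairCode (pairCode ca cc) cons) (codeList cb) fun x => x.2.2 :=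
      Poly.comp (g := Prod.snd) (.rest fun _ => rfl) .snd
    have h₃ : Poly R (pairCode (pairCode ca cc) cons) cγ
        fun x => ((x.1.1, step x.1.1 x.1.2 x.2.1), x.2.2) :=
      (((Poly.fst (cb := cc)).comp .fst).pair (hstep.comp (Poly.fst.pair h₁))).pair h₂
    have hne : ∀ x : {x // t x = true}, x.1.2 ≠ [] := fun x => by simpa [t] using x.2
    refine (h₃.reindex (fun x : {x // t x = true} => (x.1.1, (x.1.2.head (hne x), x.1.2.tail))) ?_).congr ?_
    · rintro ⟨⟨x, _ | ⟨b, l⟩⟩, hx⟩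
      · simp [t] at hx
      · rfl
    · rintro ⟨⟨x, _ | ⟨b, l⟩⟩, hx⟩
      · simp [t] at hx
      · rfl
  have hlen : ∀ (x : (α × γ) × List β), (cγ x).length =
      4 * (ca x.1.1).length + 4 * (cc x.1.2).length + 2 * (codeList cb x.2).length + 6 := fun x => by
    simp [cγ, pairCode]; ring
  -- Argument and remaining list never exceed their initial size. The accumulator is bounded by `q`
  -- and enters with factor `4`, as it lies inside two nested blocks.
  have main := Poly.iterate ht hF i (fun a => (l a).length) (Polynomial.X + 4 * q)
    (fun a k hk => by simpa [iter' k a hk.le, t] using hk) (fun a => by simp [iter' _ a le_rfl, t])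
    (fun a => ?_) (fun a k hk => ?_)
  · refine Poly.congr (((Poly.snd (ca := ca) (cb := cc)).comp Poly.fst).comp (main.comp
      (f := fun a => a) (((Poly.id ca).pair hs).pair hl |>.congr fun a => rfl))) fun a => ?_
    rw [iter' _ a le_rfl]
    simp
  · have := length_le_length_codeList (ca := cb) (l a)
    rw [hlen]
    simp [i]
    omega
  · rw [iter' k a hk, hlen, hlen]
    have h₁ := hq a _ (List.take_prefix k (l a))
    have h₂ : q.eval (ca a).length ≤ q.eval (4 * (ca (i a).1.1).length +
        4 * (cc (i a).1.2).length + 2 * (codeList cb (i a).2).length + 6) :=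
      monotone_eval q (by simp [i]; omega)
    have h₃ : (codeList cb (l a)).length =
        (codeList cb ((l a).take k)).length + (codeList cb ((l a).drop k)).length := by
      rw [← List.length_append, ← codeList_append, List.take_append_drop]
    simp [i] at h₂ ⊢
    omega

theorem Poly.flatMap {l : α → List β} {f : α → β → List γ} (hl : Poly R ca (codeList cb) l)
    (hf : Poly R (pairCode ca cb) (codeList cc) fun x => f x.1 x.2) :
    Poly R ca (codeList cc) fun a => (l a).flatMap (f a) := by
  have key : ∀ (a : α) (l : List β) (s : List γ),
      l.foldl (fun s b => s ++ f a b) s = s ++ l.flatMap (f a) := fun a l => by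
    induction l with
    | nil => simp
    | cons b l ih => simp [ih]
  have ⟨_, p, hp⟩ := hl
  have ⟨_, p', hp'⟩ := hf
  refine (Poly.foldl (s := fun _ => []) (step := fun a s b => s ++ f a b) hl (.const _ _ [])
    ((Poly.snd.comp .fst).listAppend (hf.comp ((Poly.fst.comp .fst).pair .snd)))
    -- There are at most `p` members, each of size at most `p`, and `2 * X + 2 * p + 2` bounds the
    -- code of the pair of the argument and a member.
    (p * p'.comp (2 * Polynomial.X + 2 * p + 2)) fun a l' hl' => ?_).congr
      fun a => by rw [key, List.nil_append]
  rw [key, List.nil_append]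
  have h₁ : ∀ b ∈ l', (codeList cc (f a b)).length ≤
      p'.eval (2 * (ca a).length + 2 * p.eval (ca a).length + 2) := fun b hb => by
    refine (hp' (a, b)).2.trans (monotone_eval p' ?_)
    have := (length_le_of_mem_codeList (ca := cb) (hl'.subset hb)).trans (hp a).2
    simp [pairCode]
    omega
  have h₂ : (codeList cc (l'.flatMap (f a))).length ≤
      l'.length * p'.eval (2 * (ca a).length + 2 * p.eval (ca a).length + 2) := by
    clear hl'
    induction l' with
    | nil => simp
    | cons b l' ih =>
      have := ih fun b hb => h₁ b (List.mem_cons_of_mem _ hb)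
      have := h₁ b List.mem_cons_self
      rw [List.flatMap_cons, codeList_append, List.length_append, List.length_cons, add_mul, one_mul]
      omega
  refine h₂.trans ?_
  simp only [Polynomial.eval_mul, Polynomial.eval_comp, Polynomial.eval_add, Polynomial.eval_X,
    Polynomial.eval_ofNat]
  exact Nat.mul_le_mul_right _ ((hl'.length_le.trans (length_le_length_codeList _)).trans (hp a).2)

theorem Poly.any {l : α → List β} {f : α → β → Bool} (hl : Poly R ca (codeList cb) l)
    (hf : Poly R (pairCode ca cb) codeBool fun x => f x.1 x.2) :
    Poly R ca codeBool fun a => (l a).any (f a) := by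
  have key : ∀ (a : α) (l : List β) (s : Bool),
      l.foldl (fun s b => s || f a b) s = (s || l.any (f a)) := fun a l => by
    induction l with
    | nil => simp
    | cons b l ih => simp [ih, Bool.or_assoc]
  refine (Poly.foldl (s := fun _ => false) (step := fun a s b => s || f a b) hl (.const _ _ false)
    ((Poly.snd.comp .fst).or (hf.comp ((Poly.fst.comp .fst).pair .snd))) 1 fun a l' hl' => ?_).congr
      fun a => by rw [key, Bool.false_or]
  simp

theorem Poly.all {l : α → List β} {f : α → β → Bool} (hl : Poly R ca (codeList cb) l)
    (hf : Poly R (pairCode ca cb) codeBool fun x => f x.1 x.2) :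
    Poly R ca codeBool fun a => (l a).all (f a) :=
  (Poly.any hl (f := fun a b => !f a b) hf.not).not.congr fun a => by simp [List.all_eq_not_any_not]

theorem Poly.filter {l : α → List β} {f : α → β → Bool} (hl : Poly R ca (codeList cb) l)
    (hf : Poly R (pairCode ca cb) codeBool fun x => f x.1 x.2) :
    Poly R ca (codeList cb) fun a => (l a).filter (f a) :=
  (Poly.flatMap hl (f := fun a b => if f a b then [b] else [])
    (.ite hf (.singleton .snd) (.const _ _ []))).congr fun a => by
      congr 1
      induction l a with
      | nil => rfl
      | cons b l ih => by_cases h : f a b = true <;> simp [h, ih]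

theorem Poly.eq (hcb : Function.Injective cb) {f g : α → β} {d : ∀ a, Decidable (f a = g a)}
    (hf : Poly R ca cb f) (hg : Poly R ca cb g) : Poly R ca codeBool fun a => decide (f a = g a) :=
  .binary hf hg .eq 13 (fun a => by
    have := Does.eq (R := R) (cb (f a)) (cb (g a))
    rw [decide_eq_decide.2 hcb.eq_iff] at this
    exact this.mono (by omega)) fun a => by simp

theorem Poly.mem (hcb : Function.Injective cb) {f : α → β} {l : α → List β}
    {d : ∀ a, Decidable (f a ∈ l a)} (hf : Poly R ca cb f) (hl : Poly R ca (codeList cb) l) :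
    Poly R ca codeBool fun a => decide (f a ∈ l a) := by
  classical
  refine (Poly.any hl (f := fun a b => decide (f a = b)) (.eq hcb (hf.comp .fst) .snd)).congr
    fun a => ?_
  congr 1
  rw [Bool.eq_iff_iff]
  simp

end Functions

end Cplx

namespace Cplx

/-! ### Subroutines and certificates -/

section Subroutines

open Turing TM2

/-- The number of push operations in a statement. -/
def pushes {K : Type} {Γ : K → Type} {Λ σ : Type} : Stmt Γ Λ σ → ℕ
  | .push _ _ q => pushes q + 1
  | .peek _ _ q => pushes q
  | .pop _ _ q => pushes q
  | .load _ q => pushes q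
  | .branch _ q₁ q₂ => pushes q₁ + pushes q₂
  | .goto _ => 0
  | .halt => 0

theorem length_stepAux_le {K : Type} [DecidableEq K] {Γ : K → Type} {Λ σ : Type} (q : Stmt Γ Λ σ)
    (v : σ) (S : ∀ k, List (Γ k)) (k : K) :
    ((stepAux q v S).stk k).length ≤ (S k).length + pushes q := by
  induction q generalizing v S with
  | push j f q ih =>
    refine (ih v _).trans ?_
    by_cases h : k = j
    · subst h; simp [pushes]; try omega
    · simp [pushes, h]; try omega
  | peek j f q ih => exact ih _ _
  | pop j f q ih =>
    refine (ih _ _).trans ?_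
    by_cases h : k = j
    · subst h; simp [pushes]
    · simp [pushes, h]
  | load f q ih => exact ih _ _
  | branch f q₁ q₂ ih₁ ih₂ =>
    have := ih₁ v S
    have := ih₂ v S
    cases h : f v <;> simp [h, pushes] <;> omega
  | goto f => simp [pushes]
  | halt => simp [pushes]

variable {ι : Type} {tm : ι → TM2ComputableAux Bool Bool}

theorem length_iterate_step_le (M : FinTM2) (k : M.K) (n : ℕ) (c c' : Cfg M.Γ M.Λ M.σ)
    (h : (flip bind M.step)^[n] (some c) = some c') :
    (c'.stk k).length ≤ (c.stk k).length + n * ∑ l, pushes (M.m l) := by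
  induction n generalizing c with
  | zero => cases Option.some.inj h; simp
  | succ n ih =>
    rw [Function.iterate_succ_apply] at h
    obtain ⟨l, v, S⟩ := c
    cases l with
    | none =>
      have : flip bind M.step (some ⟨none, v, S⟩) = none := rfl
      rw [this, iterate_flip_bind_none] at h
      cases h
    | some l =>
      have h₁ := ih (stepAux (M.m l) v S) h
      have h₂ := length_stepAux_le (M.m l) v S k
      have h₃ : pushes (M.m l) ≤ ∑ l, pushes (M.m l) :=
        Finset.single_le_sum (f := fun l => pushes (M.m l)) (fun _ _ => Nat.zero_le _)
          (Finset.mem_univ l)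
      rw [add_mul, one_mul]
      dsimp only
      omega

theorem length_update_nil_le {K : Type} [DecidableEq K] {Γ : K → Type} (k k' : K)
    (l : List (Γ k')) : (Function.update (fun k => ([] : List (Γ k))) k' l k).length ≤ l.length := by
  by_cases h : k = k'
  · subst h; simp
  · simp [h]

/-- A single step may push several symbols, but at most as many as its statement contains. This
turns a time bound for a machine into the bound on the output that `Poly` demands. -/
theorem behaviour_length_le {i : ι} {w w' : List Bool} {n : ℕ} (h : behaviour tm i w n w') :
    w'.length ≤ w.length + n * ∑ l, pushes ((tm i).tm.m l) := by
  have h₁ := length_iterate_step_le (tm i).tm (tm i).tm.k₁ n _ _ h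
  have h₂ : (((haltList (tm i).tm (w'.map (tm i).outputAlphabet.invFun)).stk) (tm i).tm.k₁).length =
      w'.length := by rw [haltList_stk]; simp
  have h₃ : (((initList (tm i).tm (w.map (tm i).inputAlphabet.invFun)).stk) (tm i).tm.k₁).length ≤
      w.length := by
    rw [initList_stk]
    refine (length_update_nil_le _ _ _).trans ?_
    simp
  exact h₂ ▸ h₁.trans (Nat.add_le_add_right h₃ _)

/-- A function that is computed by a subroutine in polynomial time. -/
theorem Poly.call (i : ι) {α β : Type*} {ca : α → List Bool} {cb : β → List Bool} {f : α → β}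
    (p : Polynomial ℕ)
    (h : ∀ a, ∃ n ≤ p.eval (ca a).length, behaviour tm i (ca a) n (cb (f a))) :
    Poly (behaviour tm) ca cb f := by
  let C := ∑ l, pushes ((tm i).tm.m l)
  have hlen : ∀ a, (cb (f a)).length ≤ (ca a).length + p.eval (ca a).length * C := fun a => by
    obtain ⟨n, hn, h⟩ := h a
    exact (behaviour_length_le h).trans (Nat.add_le_add_left (Nat.mul_le_mul_right _ hn) _)
  refine ⟨.seq (.move 0 1) (.seq (.call i) (.seq (.push 0 none) (.move 2 0))),
    20 + 20 * Polynomial.X + p + 20 * (p * Polynomial.C C), fun a => ⟨fun r => ?_, ?_⟩⟩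
  · obtain ⟨n, hn, h⟩ := h a
    have h₁ := Runs.move_zero_one (R := behaviour tm) (ca a) (enc r) [] [] []
    have h₂ : Runs (behaviour tm) (.call i) (regs (enc r) ((ca a).reverse.map some) [] []) _ _ :=
      ⟨_, le_rfl, .call h rfl rfl⟩
    have h₃ := Runs.move_two_zero (R := behaviour tm) (cb (f a)).reverse (none :: enc r) [] []
    simp only [List.append_nil, List.reverse_reverse, List.length_reverse, update_regs_one,
      update_regs_two] at h₁ h₂ h₃
    have := h₁.seq (h₂.seq ((Runs.push_zero none _ _ _ _).seq h₃))
    have h₄ := hlen a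
    rw [List.singleton_append, List.singleton_append, enc_cons, enc_cons]
    exact this.mono (by simp; omega)
  · refine (hlen a).trans ?_
    simp
    omega

/-- A problem is in `NP` with oracle `O` if its positive instances have certificates, as long as the
instance, such that from instance and certificate a bit, which has to be true, and an oracle
query, which has to have a positive answer, are computable in polynomial time. -/
theorem inNP_of_poly [Fintype ι] [DecidableEq ι] {α β : Type*} {code : α → List Bool}
    {cb : β → List Bool} {O : Set (List Bool)} {L : Set α} {bit : α → List Bool → Bool}
    {query : α → List Bool → β}
    (hbit : Poly (behaviour tm) (pairCode code fun w => w) codeBool fun x => bit x.1 x.2)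
    (hquery : Poly (behaviour tm) (pairCode code fun w => w) cb fun x => query x.1 x.2)
    (hL : ∀ a, a ∈ L ↔
      ∃ g : List Bool, g.length = (code a).length ∧ bit a g = true ∧ cb (query a g) ∈ O) :
    InNP O code L := by
  obtain ⟨c, p, hc⟩ := hbit
  obtain ⟨c', p', hc'⟩ := hquery
  -- The command assembles the code of the pair on stack `0`, duplicates it, computes the bit, then
  -- the query from the other copy, and moves the query to stack `1`. Reading the guess from stack
  -- `2` reverses it, which does not matter as all words of its length are guessed. The pair has a
  -- code of length `4 * (code a).length + 2`.
  refine inNP_of_exec (tm := tm)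
    (c := .seq (.push 0 none) (.seq (.move 2 0) (.seq (.push 0 none) (.seq (.move 1 0)
      (.seq (.seq .block (.seq .swap (.seq .block (.seq .swap (.seq .append (.seq .dup (.seq c
        (.seq .swap c')))))))) (.move 0 1))))))
    (p := 1000 + 1000 * Polynomial.X + 10 * p.comp (4 * Polynomial.X + 2) +
      10 * p'.comp (4 * Polynomial.X + 2))
    (fun a g => bit a g.reverse) (fun a g => cb (query a g.reverse)) (fun a g hg => ?_) fun a => ?_
  · have hx : (pairCode code (fun w => w) (a, g.reverse)).length = 4 * (code a).length + 2 := by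
      simp [pairCode, hg]; omega
    have h₁ := Runs.move_two_zero (R := behaviour tm) g [none] ((code a).reverse.map some) []
    have h₂ := Runs.move_one_zero (R := behaviour tm) (code a).reverse (none :: enc [g.reverse]) [] []
    have h₃ := (Does.block (R := behaviour tm) (code a)).frame [g.reverse]
    have h₄ := Does.swap (R := behaviour tm) (Cplx.block (code a)) g.reverse
    have h₅ := (Does.block (R := behaviour tm) g.reverse).frame [Cplx.block (code a)]
    have h₆ := Does.swap (R := behaviour tm) (Cplx.block g.reverse) (Cplx.block (code a))
    have h₇ := Does.append (R := behaviour tm) (Cplx.block (code a)) (Cplx.block g.reverse)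
    have h₈ := Does.dup (R := behaviour tm) (pairCode code (fun w => w) (a, g.reverse))
    have h₉ := (hc (a, g.reverse)).1.frame [pairCode code (fun w => w) (a, g.reverse)]
    have h₁₀ := Does.swap (R := behaviour tm) (codeBool (bit a g.reverse))
      (pairCode code (fun w => w) (a, g.reverse))
    have h₁₁ := (hc' (a, g.reverse)).1.frame [codeBool (bit a g.reverse)]
    have h₁₂ := Runs.move_zero_one (R := behaviour tm) (cb (query a g.reverse))
      (enc [codeBool (bit a g.reverse)]) [] [] []
    have hd := (h₃.seq (h₄.seq (h₅.seq (h₆.seq (h₇.seq (h₈.seq (h₉.seq (h₁₀.seq h₁₁)))))))) []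
    simp only [List.append_nil, List.reverse_reverse, List.length_reverse] at h₁ h₂ h₁₂
    have e₁ : enc [g.reverse] = g.reverse.map some ++ [none] := by simp [enc]
    have e₂ : (code a).map some ++ none :: enc [g.reverse] = enc [code a, g.reverse] := by simp
    have e₃ : (cb (query a g.reverse)).map some ++ none :: enc [codeBool (bit a g.reverse)] =
        enc [cb (query a g.reverse), codeBool (bit a g.reverse)] := by simp
    rw [← e₁] at h₁
    rw [e₂] at h₂
    rw [e₃] at h₁₂
    have hall := (Runs.push_zero (R := behaviour tm) none [] ((code a).reverse.map some)
      (g.map some) []).seq (h₁.seq ((Runs.push_zero none _ _ _ _).seq (h₂.seq (hd.seq h₁₂))))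
    have hl := (hc (a, g.reverse)).2
    have hq := (hc' (a, g.reverse)).2
    simp only [hx] at hl hq hall
    obtain ⟨n, hn, h⟩ := hall
    refine ⟨n, hn.trans ?_, _, h, rfl, rfl, hq.trans ?_⟩
    · simp [hg] at hl hq ⊢
      omega
    · simp
      omega
  · rw [hL]
    constructor
    · rintro ⟨g, hg, h⟩
      exact ⟨g.reverse, by simpa using hg, by simpa using h⟩
    · rintro ⟨g, hg, h⟩
      exact ⟨g.reverse, by simpa using hg, h⟩

end Subroutines

/-! ### Codes of atoms and selection of sublists -/

section Sums

variable {ι : Type} {R : Calls ι} {α β γ δ A T : Type*} {ca : α → List Bool} {cd : δ → List Bool}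
  {codeA : A → List Bool} {codeT : T → List Bool}

/-- The first bit of the code tells the kind of the atom and its tail is the code of the content.
Working on subtypes makes the projections total. -/
theorem Poly.sumElim {b : α → A ⊕ T} {f : α → A → δ} {g : α → T → δ}
    (hb : Poly R ca (codeAtom codeA codeT) b)
    (hf : Poly R (pairCode ca codeA) cd fun x => f x.1 x.2)
    (hg : Poly R (pairCode ca codeT) cd fun x => g x.1 x.2) :
    Poly R ca cd fun a => (b a).elim (f a) (g a) := by
  have key : Poly R (pairCode ca (codeAtom codeA codeT)) cd fun x => x.2.elim (f x.1) (g x.1) := by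
    refine .cases (t := fun x => x.2.isRight) (Poly.comp (g := Sum.isRight)
      (.test (fun o => o == some true) fun b => by cases b <;> rfl) .snd) ?_ ?_
    · have h₁ : Poly R (fun b : {b : A ⊕ T // b.isRight = true} => codeAtom codeA codeT b) codeT
          fun b => b.1.getRight b.2 := .tail fun ⟨b, hb⟩ => by
        cases b with
        | inl a => simp at hb
        | inr s => rfl
      have h₂ : Poly R (fun x : {x : α × (A ⊕ T) // x.2.isRight = true} =>
          pairCode ca (codeAtom codeA codeT) x)
          (fun b : {b : A ⊕ T // b.isRight = true} => codeAtom codeA codeT b)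
          fun x => ⟨x.1.2, x.2⟩ := (Poly.snd.reindex Subtype.val fun _ => rfl).congr fun _ => rfl
      refine (hg.comp ((Poly.fst.reindex Subtype.val fun _ => rfl).pair (h₁.comp h₂))).congr ?_
      rintro ⟨⟨a, b⟩, hb⟩
      cases b with
      | inl a => simp at hb
      | inr s => rfl
    · have h₁ : Poly R (fun b : {b : A ⊕ T // b.isRight = false} => codeAtom codeA codeT b) codeA
          fun b => b.1.getLeft (by simpa using b.2) := .tail fun ⟨b, hb⟩ => by
        cases b with
        | inl a => rfl
        | inr s => simp at hb
      have h₂ : Poly R (fun x : {x : α × (A ⊕ T) // x.2.isRight = false} =>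
          pairCode ca (codeAtom codeA codeT) x)
          (fun b : {b : A ⊕ T // b.isRight = false} => codeAtom codeA codeT b)
          fun x => ⟨x.1.2, x.2⟩ := (Poly.snd.reindex Subtype.val fun _ => rfl).congr fun _ => rfl
      refine (hf.comp ((Poly.fst.reindex Subtype.val fun _ => rfl).pair (h₁.comp h₂))).congr ?_
      rintro ⟨⟨a, b⟩, hb⟩
      cases b with
      | inl a => rfl
      | inr s => simp at hb
  exact key.comp ((Poly.id ca).pair hb)

theorem Poly.inl : Poly R codeA (codeAtom codeA codeT) Sum.inl :=
  (Poly.const codeA (fun w => w) [false]).append (.id codeA) fun _ => rfl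

theorem Poly.inr : Poly R codeT (codeAtom codeA codeT) Sum.inr :=
  (Poly.const codeT (fun w => w) [true]).append (.id codeT) fun _ => rfl

theorem injective_codeAtom (hA : Function.Injective codeA) (hT : Function.Injective codeT) :
    Function.Injective (codeAtom codeA codeT) := by
  rintro (a | s) (a' | s') h <;> simp only [codeAtom, List.cons.injEq] at h
  · rw [hA h.2]
  · exact absurd h.1 (by decide)
  · exact absurd h.1 (by decide)
  · rw [hT h.2]

/-- Selects the members of a list that are marked by the first bits of a word, and returns the
remaining bits, too. -/
def select (g : List Bool) (l : List α) : List Bool × List α :=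
  l.foldl (fun s b => (s.1.tail, if s.1.head? == some true then s.2 ++ [b] else s.2)) (g, [])

/-- Every sublist obtained by filtering is selected by its characteristic word, and the unused bits
remain for the next selection. -/
theorem select_eq (p : α → Bool) (g : List Bool) (l : List α) :
    select (l.map p ++ g) l = (g, l.filter p) := by
  have key : ∀ (l acc : List α), l.foldl (fun (s : List Bool × List α) b =>
      (s.1.tail, if s.1.head? == some true then s.2 ++ [b] else s.2)) (l.map p ++ g, acc) =
      (g, acc ++ l.filter p) := by
    intro l
    induction l with
    | nil => simp
    | cons b l ih =>
      intro acc
      have := ih (if p b = true then acc ++ [b] else acc)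
      cases hb : p b <;> simpa [hb] using this
  exact key l []

theorem Poly.select {cb : β → List Bool} {g : α → List Bool} {l : α → List β}
    (hg : Poly R ca (fun w => w) g) (hl : Poly R ca (codeList cb) l) :
    Poly R ca (pairCode (fun w => w) (codeList cb)) fun a => Cplx.select (g a) (l a) := by
  have ⟨_, p, hp⟩ := hg
  have ⟨_, p', hp'⟩ := hl
  have h₁ : Poly R (pairCode (pairCode ca (pairCode (fun w => w) (codeList cb))) cb) (fun w => w)
      fun x => x.1.2.1 := Poly.fst.comp (Poly.snd.comp .fst)
  have h₂ : Poly R (pairCode (pairCode ca (pairCode (fun w => w) (codeList cb))) cb) (codeList cb)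
      fun x => x.1.2.2 := Poly.snd.comp (Poly.snd.comp .fst)
  refine .foldl (s := fun a => (g a, [])) (step := fun _ s b => (s.1.tail,
      if s.1.head? == some true then s.2 ++ [b] else s.2)) hl (hg.pair (.const _ _ []))
    (.pair (Poly.comp (g := List.tail) (.tail fun _ => rfl) h₁) (.ite
      (Poly.comp (g := fun w : List Bool => w.head? == some true) (.test (fun o => o == some true)
        fun _ => rfl) h₁) (h₂.listAppend (.singleton .snd)) h₂)) (2 * p + 2 * p' + 2)
      fun a l' hl' => ?_
  have key : ∀ (l : List β) (g : List Bool) (acc : List β), (pairCode (fun w => w) (codeList cb)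
      (l.foldl (fun (s : List Bool × List β) b => (s.1.tail, if s.1.head? == some true then s.2 ++ [b]
        else s.2)) (g, acc))).length ≤
      2 * g.length + 2 * (codeList cb acc).length + 2 * (codeList cb l).length + 2 := by
    intro l
    induction l with
    | nil => intro g acc; simp [pairCode]; omega
    | cons b l ih =>
      intro g acc
      refine (ih _ _).trans ?_
      split <;> simp <;> omega
  refine (key l' (g a) []).trans ?_
  have h₃ := (hp a).2
  have h₄ := (hp' a).2
  obtain ⟨l'', hl''⟩ := hl'
  rw [← hl'', codeList_append] at h₄
  simp at h₃ h₄ ⊢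
  omega

end Sums

end Cplx

namespace Cplx

open TProg

/-! ### Evaluation of programs in polynomial time -/

section Rules

variable {ι : Type} {R : Calls ι} {α A T : Type*} {ca : α → List Bool}
  {codeA : A → List Bool} {codeT : T → List Bool}

theorem Poly.head : Poly R (codeRule codeA codeT) (codeHead codeA codeT) Rule.head :=
  .first fun _ => List.append_assoc _ _ _

theorem Poly.body : Poly R (codeRule codeA codeT)
    (pairCode (codeList (codeAtom codeA codeT)) (codeList (codeAtom codeA codeT)))
    fun r => (r.pos, r.neg) :=
  .rest fun _ => List.append_assoc _ _ _

/-- Codes of atoms are nonempty, so an empty code identifies the head `⊥`; otherwise the list is the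
block of the code. -/
theorem Poly.headToList : Poly R (codeRule codeA codeT) (codeList (codeAtom codeA codeT))
    fun r => r.head.toList := by
  refine Poly.comp (g := Option.toList) (.cases (t := Option.isSome) (.test Option.isSome fun o => ?_)
    (.block (cb := codeHead codeA codeT) (f := fun o => o.1)
      ((Poly.id _).reindex Subtype.val fun _ => rfl) fun o => ?_)
    ((Poly.const _ (codeList (codeAtom codeA codeT)) []).congr fun o => ?_)) .head
  · rcases o with _ | _ | _ <;> rfl
  · obtain ⟨_ | b, h⟩ := o
    · simp at h
    · simp [codeHead]
  · obtain ⟨_ | b, h⟩ := o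
    · rfl
    · simp at h

theorem Poly.atoms : Poly R (codeRule codeA codeT) (codeList (codeAtom codeA codeT)) Rule.atoms :=
  (Poly.headToList.listAppend (Poly.fst.comp .body)).listAppend (Poly.snd.comp .body)

open Classical in
/-- Whether a rule holds with true atoms `M` and atoms `N` that are relevant for negation. -/
noncomputable def holdsIn (M N : List (A ⊕ T)) (r : Rule A T) : Bool :=
  !((r.pos.all fun b => decide (b ∈ M)) && r.neg.all fun b => !decide (b ∈ N)) ||
    r.head.toList.any fun b => decide (b ∈ M)

theorem holdsIn_iff (M N : List (A ⊕ T)) (r : Rule A T) :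
    holdsIn M N r = true ↔ r.Holds (fun b => b ∈ M) fun b => b ∈ N := by
  have h : (∃ b, r.head = some b ∧ b ∈ M) ↔ ∃ b ∈ r.head.toList, b ∈ M := by simp
  rw [holdsIn, Rule.Holds, h, ← and_imp, imp_iff_not_or, Bool.or_eq_true, Bool.not_eq_true',
    ← Bool.not_eq_true, Bool.and_eq_true, List.all_eq_true, List.all_eq_true, List.any_eq_true]
  simp only [decide_eq_true_eq, Bool.not_eq_true', decide_eq_false_iff_not]

/-- Whether all rules hold in the here-and-there interpretation with true atoms `M` and `N`. -/
noncomputable def allHoldIn (M N : List (A ⊕ T)) (P : List (Rule A T)) : Bool :=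
  P.all fun r => holdsIn M N r && holdsIn N N r

theorem allHoldIn_iff (M N : List (A ⊕ T)) (P : List (Rule A T)) :
    allHoldIn M N P = true ↔ HoldsAll (fun b => b ∈ M) (fun b => b ∈ N) P := by
  simp [allHoldIn, HoldsAll, holdsIn_iff]

theorem Poly.holdsIn (hA : Function.Injective codeA) (hT : Function.Injective codeT)
    {M N : α → List (A ⊕ T)} {r : α → Rule A T}
    (hM : Poly R ca (codeList (codeAtom codeA codeT)) M)
    (hN : Poly R ca (codeList (codeAtom codeA codeT)) N) (hr : Poly R ca (codeRule codeA codeT) r) :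
    Poly R ca codeBool fun a => Cplx.holdsIn (M a) (N a) (r a) := by
  have hAT := injective_codeAtom hA hT
  exact .or (.not (.and (.all (Poly.fst.comp (Poly.body.comp hr)) (.mem hAT .snd (hM.comp .fst)))
    (.all (Poly.snd.comp (Poly.body.comp hr)) (.not (.mem hAT .snd (hN.comp .fst))))))
    (.any (Poly.headToList.comp hr) (.mem hAT .snd (hM.comp .fst)))

theorem Poly.allHoldIn (hA : Function.Injective codeA) (hT : Function.Injective codeT)
    {M N : α → List (A ⊕ T)} {P : α → List (Rule A T)}
    (hM : Poly R ca (codeList (codeAtom codeA codeT)) M)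
    (hN : Poly R ca (codeList (codeAtom codeA codeT)) N) (hP : Poly R ca (codeProgram codeA codeT) P) :
    Poly R ca codeBool fun a => Cplx.allHoldIn (M a) (N a) (P a) :=
  .all (cb := codeRule codeA codeT) hP (.and
    (.holdsIn hA hT (hM.comp .fst) (hN.comp .fst) .snd)
    (.holdsIn hA hT (hN.comp .fst) (hN.comp .fst) .snd))

theorem length_atoms_le (r : Rule A T) : 2 * r.atoms.length ≤ (codeRule codeA codeT r).length := by
  have h : ∀ l : List (A ⊕ T), 3 * l.length ≤ (codeList (codeAtom codeA codeT) l).length := by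
    intro l
    induction l with
    | nil => simp
    | cons b l ih =>
      have : 1 ≤ (codeAtom codeA codeT b).length := by cases b <;> simp [codeAtom]
      simp; omega
  have h₁ := h r.pos
  have h₂ := h r.neg
  have h₃ : r.head.toList.length ≤ (codeHead codeA codeT r.head).length := by
    rcases r.head with _ | _ | _ <;> simp [codeHead, codeAtom]
  simp [Rule.atoms, codeRule]
  omega

/-- The block around each rule doubles the bound of `length_atoms_le`. Thus three marks for each
atom fit into a certificate that is exactly as long as the input. -/
theorem length_flatMap_atoms_le (P : List (Rule A T)) :
    4 * (P.flatMap Rule.atoms).length ≤ (codeProgram codeA codeT P).length := by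
  induction P with
  | nil => simp
  | cons r P ih =>
    have := length_atoms_le (codeA := codeA) (codeT := codeT) r
    simp [codeProgram] at ih ⊢
    omega

end Rules

/-! ### Truth of atoms and the oracle query -/

section Interpretations

variable {ι : Type} {R : Calls ι} {α A T X : Type*} {ca : α → List Bool}
  {codeA : A → List Bool} {codeT : T → List Bool} {codeX : X → List Bool}

open Classical in
/-- Whether an atom is true in the least interpretation in which the variables in `V` and the atoms
in `M` are defined, where the theory atoms in `W` are satisfied by the assignment. -/
noncomputable def truthIn (varList : T → List X) (V : X → Bool) (W M : List (A ⊕ T)) (b : A ⊕ T) : Bool :=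
  b.elim (fun a => decide (.inl a ∈ M)) fun s => decide (.inr s ∈ W) &&
    (varList s).all fun x => V x || M.any fun b' => b'.elim (fun _ => false) fun s' =>
      decide (x ∈ varList s')

theorem truthIn_iff {D : Type*} (𝔗 : StructuredTheory T X D) {varList : T → List X}
    (hvar : ∀ s x, x ∈ varList s ↔ x ∈ 𝔗.vars s) {V : X → Bool} {V' : Set X}
    (hV : ∀ x, V x = true ↔ x ∈ V') (W M : List (A ⊕ T)) (b : A ⊕ T) :
    truthIn varList V W M b = true ↔ Truth 𝔗 V' W M b := by
  cases b with
  | inl a => simp [truthIn, Truth]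
  | inr s => simp [truthIn, Truth, hvar, hV]

theorem Poly.truthIn (hA : Function.Injective codeA) (hT : Function.Injective codeT)
    (hX : Function.Injective codeX) {varList : T → List X}
    (hvar : Poly R codeT (codeList codeX) varList) {V : α → X → Bool}
    (hV : Poly R (pairCode ca codeX) codeBool fun x => V x.1 x.2) {W M : α → List (A ⊕ T)}
    (hW : Poly R ca (codeList (codeAtom codeA codeT)) W)
    (hM : Poly R ca (codeList (codeAtom codeA codeT)) M) {b : α → A ⊕ T}
    (hb : Poly R ca (codeAtom codeA codeT) b) :
    Poly R ca codeBool fun a => Cplx.truthIn varList (V a) (W a) (M a) (b a) := by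
  have hAT := injective_codeAtom hA hT
  exact .sumElim hb (.mem hAT (Poly.inl.comp .snd) (hM.comp .fst)) (.and
    (.mem hAT (Poly.inr.comp .snd) (hW.comp .fst)) (.all (hvar.comp .snd) (.or
      (hV.comp ((Poly.fst.comp .fst).pair .snd)) (.any (hM.comp (Poly.fst.comp .fst)) (.sumElim .snd
        (.const _ _ false) (.mem hX (Poly.snd.comp (Poly.fst.comp .fst)) (hvar.comp .snd)))))))

open Classical in
/-- The theory atoms in `L`, with the ones that are not in `W` replaced by their complements. -/
noncomputable def signed (comp : T → T) (W L : List (A ⊕ T)) : List T :=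
  L.flatMap fun b => b.elim (fun _ => []) fun s => if decide (.inr s ∈ W) then [s] else [comp s]

/-- By absolute complement, an assignment satisfies all signed atoms iff the atoms of `L` that it
satisfies are exactly those in `W`; by compositionality, satisfiability means that such an
assignment exists. A single query therefore certifies `w`. -/
theorem signed_mem_sat {D : Type*} {𝔗 : StructuredTheory T X D} (hcomp : 𝔗.Compositional)
    (habs : 𝔗.AbsoluteComplement) (W L : List (A ⊕ T)) :
    {s | s ∈ signed 𝔗.comp W L} ∈ 𝔗.Sat ↔
      ∃ w : X → D, ∀ s, .inr s ∈ L → (w ∈ 𝔗.den s ↔ .inr s ∈ W) := by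
  rw [hcomp]
  refine exists_congr fun w => ?_
  simp only [StructuredTheory.denSet, Set.mem_iInter, Set.mem_ofPred_eq, signed, List.mem_flatMap]
  constructor
  · intro h s hs
    by_cases hW : (.inr s : A ⊕ T) ∈ W
    · exact iff_of_true (h s ⟨_, hs, by simp [hW]⟩) hW
    · have := h (𝔗.comp s) ⟨_, hs, by simp [hW]⟩
      rw [habs] at this
      exact iff_of_false this hW
  · rintro h s ⟨a | s', hs', hs⟩
    · simp at hs
    · by_cases hW : (.inr s' : A ⊕ T) ∈ W
      · simp [hW] at hs
        subst hs
        exact (h s hs').2 hW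
      · simp [hW] at hs
        subst hs
        rw [habs]
        exact fun hw => hW ((h s' hs').1 hw)

theorem Poly.signed (hA : Function.Injective codeA) (hT : Function.Injective codeT) {comp : T → T}
    (hcomp : Poly R codeT codeT comp) {W L : α → List (A ⊕ T)}
    (hW : Poly R ca (codeList (codeAtom codeA codeT)) W)
    (hL : Poly R ca (codeList (codeAtom codeA codeT)) L) :
    Poly R ca (codeList codeT) fun a => Cplx.signed comp (W a) (L a) :=
  .flatMap hL (.sumElim .snd (.const _ _ []) (.ite
    (.mem (injective_codeAtom hA hT) (Poly.inr.comp .snd) (hW.comp (Poly.fst.comp .fst)))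
    (.singleton .snd) (.singleton (hcomp.comp .snd))))

end Interpretations

/-! ### Certificates for programs that are not strongly equivalent -/

section Main

variable {A T X : Type} {D X' D' C : Type*} {𝔗 : StructuredTheory T X D}
  {S : HTc.Signature X' D' C} (e : Encodes A S 𝔗) {codeA : A → List Bool} {codeT : T → List Bool}
  {codeX : X → List Bool} {varList : T → List X} {O : Set (List Bool)}
  {ι : Type} {tm : ι → Turing.TM2ComputableAux Bool Bool}

/-- The test whether the interpretation given by `H`, `K` and `W` distinguishes two programs. -/
noncomputable def distinguishes (varList : T → List X) (V : X → Bool) (L H K W : List (A ⊕ T))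
    (P Q : List (Rule A T)) : Bool :=
  !decide (allHoldIn (L.filter (truthIn varList V W H)) (L.filter (truthIn varList V W (H ++ K))) P =
    allHoldIn (L.filter (truthIn varList V W H)) (L.filter (truthIn varList V W (H ++ K))) Q)

/-- Rules see only their own atoms, so the sets of true atoms may be cut down to the finite list
`L`. -/
theorem distinguishes_iff (hvar : ∀ s x, x ∈ varList s ↔ x ∈ 𝔗.vars s) {V : X → Bool} {V' : Set X}
    (hV : ∀ x, V x = true ↔ x ∈ V') {L : List (A ⊕ T)} (H K W : List (A ⊕ T))
    {P Q : List (Rule A T)} (hP : ∀ r ∈ P, ∀ b ∈ r.atoms, b ∈ L)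
    (hQ : ∀ r ∈ Q, ∀ b ∈ r.atoms, b ∈ L) : distinguishes varList V L H K W P Q = true ↔
      ¬ (HoldsAll (Truth 𝔗 V' W H) (Truth 𝔗 V' W (H ++ K)) P ↔
        HoldsAll (Truth 𝔗 V' W H) (Truth 𝔗 V' W (H ++ K)) Q) := by
  have key : ∀ P : List (Rule A T), (∀ r ∈ P, ∀ b ∈ r.atoms, b ∈ L) →
      (allHoldIn (L.filter (truthIn varList V W H)) (L.filter (truthIn varList V W (H ++ K))) P = true ↔
        HoldsAll (Truth 𝔗 V' W H) (Truth 𝔗 V' W (H ++ K)) P) := fun P hP => by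
    have : ∀ M, ∀ r ∈ P, ∀ b ∈ r.atoms, (b ∈ L.filter (truthIn varList V W M) ↔ Truth 𝔗 V' W M b) :=
      fun M r hr b hb => by simp [hP r hr b hb, truthIn_iff 𝔗 hvar hV]
    rw [allHoldIn_iff]
    exact holdsAll_congr (this _) (this _)
  rw [← key P hP, ← key Q hQ, ← Bool.eq_iff_iff]
  simp [distinguishes]

theorem Poly.distinguishes {α : Type*} {R : Calls ι} {ca : α → List Bool}
    (hA : Function.Injective codeA) (hT : Function.Injective codeT)
    (hX : Function.Injective codeX) (hvar : Poly R codeT (codeList codeX) varList) {V : α → X → Bool}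
    (hV : Poly R (pairCode ca codeX) codeBool fun x => V x.1 x.2) {L H K W : α → List (A ⊕ T)}
    (hL : Poly R ca (codeList (codeAtom codeA codeT)) L)
    (hH : Poly R ca (codeList (codeAtom codeA codeT)) H)
    (hK : Poly R ca (codeList (codeAtom codeA codeT)) K)
    (hW : Poly R ca (codeList (codeAtom codeA codeT)) W) {P Q : α → List (Rule A T)}
    (hP : Poly R ca (codeProgram codeA codeT) P) (hQ : Poly R ca (codeProgram codeA codeT) Q) :
    Poly R ca codeBool fun a =>
      Cplx.distinguishes varList (V a) (L a) (H a) (K a) (W a) (P a) (Q a) := by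
  have hM : ∀ {M : α → List (A ⊕ T)}, Poly R ca (codeList (codeAtom codeA codeT)) M →
      Poly R ca (codeList (codeAtom codeA codeT)) fun a =>
        (L a).filter (Cplx.truthIn varList (V a) (W a) (M a)) := fun hM =>
    .filter hL (.truthIn (V := fun x => V x.1) hA hT hX hvar
      (hV.comp ((Poly.fst.comp .fst).pair .snd)) (hW.comp .fst) (hM.comp .fst) .snd)
  have hHK := hH.listAppend hK
  exact .not (.eq (cb := codeBool) (fun b b' h => List.singleton_injective h)
    (.allHoldIn hA hT (hM hH) (hM hHK) hP) (.allHoldIn hA hT (hM hH) (hM hHK) hQ))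

/-- The lists of the atoms that are marked by the first, second and third part of a word. -/
def marked (g : List Bool) (L : List (A ⊕ T)) : List (A ⊕ T) × List (A ⊕ T) × List (A ⊕ T) :=
  ((select g L).2, (select (select g L).1 L).2, (select (select (select g L).1 L).1 L).2)

theorem Poly.marked {α : Type*} {R : Calls ι} {ca : α → List Bool} {g : α → List Bool}
    {L : α → List (A ⊕ T)} (hg : Poly R ca (fun w => w) g)
    (hL : Poly R ca (codeList (codeAtom codeA codeT)) L) :
    Poly R ca (codeList (codeAtom codeA codeT)) (fun a => (Cplx.marked (g a) (L a)).1) ∧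
    Poly R ca (codeList (codeAtom codeA codeT)) (fun a => (Cplx.marked (g a) (L a)).2.1) ∧
    Poly R ca (codeList (codeAtom codeA codeT)) (fun a => (Cplx.marked (g a) (L a)).2.2) := by
  have s₁ := Poly.select hg hL
  have s₂ := Poly.select (Poly.fst.comp s₁) hL
  have s₃ := Poly.select (Poly.fst.comp s₂) hL
  have h₁ := Poly.snd.comp s₁
  have h₂ := Poly.snd.comp s₂
  have h₃ := Poly.snd.comp s₃
  exact ⟨h₁, h₂, h₃⟩

/-- The common core of both forms: the external atoms may depend on the instance, and enter the
computation only through the test `V` for external variables. -/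
theorem inNP_not_progStronglyEquivalent [Nonempty D] [Fintype ι] [DecidableEq ι] (hcomp : 𝔗.Compositional) (habs : 𝔗.AbsoluteComplement)
    (hA : Function.Injective codeA) (hT : Function.Injective codeT) (hX : Function.Injective codeX)
    (hvar : ∀ s x, x ∈ varList s ↔ x ∈ 𝔗.vars s)
    (hvarP : Poly (behaviour tm) codeT (codeList codeX) varList)
    (hcompP : Poly (behaviour tm) codeT codeT 𝔗.comp)
    (hO : ∀ F : List T, codeList codeT F ∈ O ↔ {s | s ∈ F} ∈ 𝔗.Sat)
    {α : Type} {ca : α → List Bool} {P Q : α → List (Rule A T)}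
    (hP : Poly (behaviour tm) ca (codeProgram codeA codeT) P)
    (hQ : Poly (behaviour tm) ca (codeProgram codeA codeT) Q)
    (hlen : ∀ a, (codeProgram codeA codeT (P a)).length + (codeProgram codeA codeT (Q a)).length ≤
      (ca a).length) {V : α → X → Bool} {E : α → Set T}
    (hV : Poly (behaviour tm) (pairCode ca codeX) codeBool fun x => V x.1 x.2)
    (hVE : ∀ a x, V a x = true ↔ x ∈ 𝔗.varsSet (E a)) :
    InNP O ca {a | ¬ e.ProgStronglyEquivalent (E a) {r | r ∈ P a} {r | r ∈ Q a}} := by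
  let L : α → List (A ⊕ T) := fun a => (P a ++ Q a).flatMap Rule.atoms
  have hL : Poly (behaviour tm) ca (codeList (codeAtom codeA codeT)) L :=
    .flatMap (cb := codeRule codeA codeT) (.listAppend hP hQ) (Poly.atoms.comp .snd)
  have hL' := hL.comp (Poly.fst (cb := fun w : List Bool => w))
  obtain ⟨hH, hK, hW⟩ := Poly.marked (Poly.snd (ca := ca) (cb := fun w => w) (R := behaviour tm)) hL'
  have hV' : Poly (behaviour tm) (pairCode (pairCode ca fun w => w) codeX) codeBool
      fun x : (α × List Bool) × X => V x.1.1 x.2 :=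
    hV.comp (f := fun x : (α × List Bool) × X => (x.1.1, x.2)) ((Poly.fst.comp .fst).pair .snd)
  have hbit := Poly.distinguishes (V := fun x : α × List Bool => V x.1) hA hT hX hvarP hV' hL' hH hK
    hW (hP.comp .fst) (hQ.comp .fst)
  have hquery := Poly.signed hA hT hcompP hW hL'
  refine inNP_of_poly
    (bit := fun a g => distinguishes varList (V a) (L a) (marked g (L a)).1 (marked g (L a)).2.1
      (marked g (L a)).2.2 (P a) (Q a))
    (query := fun a g => signed 𝔗.comp (marked g (L a)).2.2 (L a)) hbit hquery fun a => ?_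
  have hPL : ∀ r ∈ P a, ∀ b ∈ r.atoms, b ∈ L a := fun r hr b hb =>
    List.mem_flatMap.2 ⟨r, List.mem_append_left _ hr, hb⟩
  have hQL : ∀ r ∈ Q a, ∀ b ∈ r.atoms, b ∈ L a := fun r hr b hb =>
    List.mem_flatMap.2 ⟨r, List.mem_append_right _ hr, hb⟩
  simp only [hO, signed_mem_sat hcomp habs, distinguishes_iff hvar (hVE a) _ _ _ hPL hQL]
  constructor
  · intro h
    obtain ⟨pH, pK, pW, hw, hd⟩ := e.exists_distinguishing _ _ _ (L a) hPL hQL h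
    have hn : 4 * (L a).length ≤ (ca a).length := by
      refine le_trans ?_ (hlen a)
      rw [← List.length_append]
      have := length_flatMap_atoms_le (codeA := codeA) (codeT := codeT) (P a ++ Q a)
      rw [codeProgram, codeList_append] at this
      exact this
    -- Three characteristic words over `L a`, padded to the length of the input.
    refine ⟨(L a).map pH ++ ((L a).map pK ++ ((L a).map pW ++
      List.replicate ((ca a).length - 3 * (L a).length) false)), by simp; omega, ?_⟩
    simp only [marked, select_eq]
    exact ⟨hd, hw⟩
  · rintro ⟨g, -, hd, w, hw⟩
    exact e.not_progStronglyEquivalent _ _ _ (L a) _ _ _ hPL hQL w hw hd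

end Main

end Cplx

/-! ### The machines of the hypotheses as subroutines, and the theorem -/

namespace Cplx
open TProg

/-- A function that is computed by one of the machines that serve as subroutines. -/
theorem Poly.of_machine {ι : Type} {tm : ι → Turing.TM2ComputableAux Bool Bool} {α β : Type}
    {ca : α → List Bool} {cb : β → List Bool} {f : α → β} (i : ι)
    (h : Turing.TM2ComputableInPolyTime ca cb f) (hi : tm i = h.toTM2ComputableAux) :
    Poly (behaviour tm) ca cb f :=
  .call i h.time fun a => ⟨(h.outputsFun a).steps, (h.outputsFun a).steps_le_m, by
    rw [behaviour, hi]; exact (h.outputsFun a).evals_in_steps⟩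

end Cplx

/-- Strong equivalence of finite `𝒯`-programs with a (consistent, compositional) theory `𝔗`
with absolute complement is in `coNP` relative to any oracle `O` for the satisfiability of finite
sets of theory atoms, both for a fixed set `E` of external atoms and for a finite `E` given in the
input. The atoms and variables are written as words such that the syntactic operations of
`𝔗` (complement and variables of an atom) are computable in polynomial time. -/
theorem mainTheorem8 {A T X : Type} {D X' D' C : Type*} [Nonempty D]
    (𝔗 : TProg.StructuredTheory T X D)
    (hcons : 𝔗.Consistent) (hcomp : 𝔗.Compositional) (habs : 𝔗.AbsoluteComplement)
    (S : HTc.Signature X' D' C) (e : TProg.Encodes A S 𝔗)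
    (codeA : A → List Bool) (hA : Function.Injective codeA)
    (codeT : T → List Bool) (hT : Function.Injective codeT)
    (codeX : X → List Bool) (hX : Function.Injective codeX)
    (varList : T → List X) (hvar : ∀ s x, x ∈ varList s ↔ x ∈ 𝔗.vars s)
    (hvarP : Nonempty (Turing.TM2ComputableInPolyTime codeT (Cplx.codeList codeX) varList))
    (hcompP : Nonempty (Turing.TM2ComputableInPolyTime codeT codeT 𝔗.comp))
    (O : Set (List Bool))
    (hO : ∀ F : List T, Cplx.codeList codeT F ∈ O ↔ {s | s ∈ F} ∈ 𝔗.Sat) :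
    (∀ (E : Set T) (inVarsE : X → Bool), (∀ x, inVarsE x = true ↔ x ∈ 𝔗.varsSet E) →
      Nonempty (Turing.TM2ComputableInPolyTime codeX Computability.encodeBool inVarsE) →
      Cplx.InCoNP O (Cplx.codePair codeA codeT)
        {x | e.ProgStronglyEquivalent E {r | r ∈ x.1} {r | r ∈ x.2}}) ∧
    Cplx.InCoNP O (Cplx.codeTriple codeA codeT)
      {x | e.ProgStronglyEquivalent {s | s ∈ x.1} {r | r ∈ x.2.1} {r | r ∈ x.2.2}} := by
  obtain ⟨mv⟩ := hvarP
  obtain ⟨mc⟩ := hcompP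
  constructor
  · rintro E inVarsE hE ⟨me⟩
    -- For fixed `E`, the machine that decides the external variables is a third subroutine.
    let tm : Fin 3 → Turing.TM2ComputableAux Bool Bool :=
      ![mv.toTM2ComputableAux, mc.toTM2ComputableAux, me.toTM2ComputableAux]
    have hV : Cplx.Poly (Cplx.behaviour tm) (Cplx.pairCode (Cplx.codePair codeA codeT) codeX)
        Cplx.codeBool fun x => inVarsE x.2 := Cplx.Poly.comp (.of_machine 2 me rfl) .snd
    refine Cplx.inNP_not_progStronglyEquivalent (tm := tm) e hcomp habs hA hT hX hvar
      (.of_machine 0 mv rfl) (.of_machine 1 mc rfl) hO (ca := Cplx.codePair codeA codeT)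
      (P := Prod.fst) (Q := Prod.snd) Cplx.Poly.fst Cplx.Poly.snd (fun x => ?_) (E := fun _ => E)
      hV fun _ => hE
    simp only [Cplx.codePair, List.length_append, Cplx.length_block]
    omega
  · let tm : Fin 2 → Turing.TM2ComputableAux Bool Bool :=
      ![mv.toTM2ComputableAux, mc.toTM2ComputableAux]
    have hv : Cplx.Poly (Cplx.behaviour tm) codeT (Cplx.codeList codeX) varList :=
      .of_machine 0 mv rfl
    have hE : Cplx.Poly (Cplx.behaviour tm) (Cplx.codeTriple codeA codeT) (Cplx.codeList codeT)
        Prod.fst := .first fun _ => rfl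
    have hPQ : Cplx.Poly (Cplx.behaviour tm) (Cplx.codeTriple codeA codeT)
        (Cplx.codePair codeA codeT) Prod.snd := .rest fun _ => rfl
    have hP : Cplx.Poly (Cplx.behaviour tm) (Cplx.codeTriple codeA codeT)
        (Cplx.codeProgram codeA codeT) fun x => x.2.1 := Cplx.Poly.fst.comp hPQ
    have hQ : Cplx.Poly (Cplx.behaviour tm) (Cplx.codeTriple codeA codeT)
        (Cplx.codeProgram codeA codeT) fun x => x.2.2 := Cplx.Poly.snd.comp hPQ
    classical
    -- Since `E` is part of the input, its variables are found by searching the variable lists of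
    -- its members.
    have hV : Cplx.Poly (Cplx.behaviour tm) (Cplx.pairCode (Cplx.codeTriple codeA codeT) codeX)
        Cplx.codeBool fun x => x.1.1.any fun s => decide (x.2 ∈ varList s) :=
      .any (f := fun x s => decide (x.2 ∈ varList s)) (hE.comp .fst)
        (.mem hX (Cplx.Poly.snd.comp .fst) (hv.comp .snd))
    refine Cplx.inNP_not_progStronglyEquivalent e hcomp habs hA hT hX hvar hv
      (.of_machine 1 mc rfl) hO hP hQ (fun x => ?_)
      (V := fun x y => x.1.any fun s => decide (y ∈ varList s)) (E := fun x => {s | s ∈ x.1})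
      hV fun x y => by simp [TProg.StructuredTheory.varsSet, hvar]
    simp only [Cplx.codeTriple, Cplx.codePair, List.length_append, Cplx.length_block]
    omega
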